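/- Let $n\in\{1,2\}$, let $m\geq 1$ be an integer, and let $q,q_0,q_1\in(-1,1)$. Put $$u_q(\theta)=\frac{1-q^2}{1-2q\cos\theta+q^2},\qquad v_q(\vartheta)=\int_0^{\vartheta}u_q(\theta)\,d\theta,$$ and let $\Lambda=\{\mu\in\mathbb{Z}^n : m\geq\mu_1\geq\cdots\geq\mu_n\geq 0\}$. For $\lambda\in\Lambda$ let $\boldsymbol{\xi}_\lambda\in\mathbb{R}^n$ be the unique global minimum of the Morse function $V_\lambda:\mathbb{R}^n\to\mathbb{R}$, $$V_\lambda(\boldsymbol{\xi})=\sum_{1\leq j<k\leq n}\Bigl(\int_0^{\xi_j+\xi_k}v_q(\vartheta)\,d\vartheta+\int_0^{\xi_j-\xi_k}v_q(\vartheta)\,d\vartheta\Bigr)+\sum_{1\leq j\leq n}\Bigl((m+1)\xi_j^2-2\pi(n+1-j+\lambda_j)\xi_j+\int_0^{\xi_j}\bigl(v_{q_0}(\vartheta)+v_{q_1}(\vartheta)\bigr)\,d\vartheta\Bigr),$$ and let $H(\boldsymbol{\xi})=\bigl[\partial_{\xi_j}\partial_{\xi_k}V_\lambda(\boldsymbol{\xi})\bigr]_{1\leq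 j,k\leq n}$ be its Hessian matrix. Put $$C(\boldsymbol{\xi})=\prod_{1\leq j\leq n}\frac{1-q_0e^{-i\xi_j}}{1-e^{-2i\xi_j}}\prod_{1\leq j<k\leq n}\frac{1-qe^{-i(\xi_j-\xi_k)}}{1-e^{-i(\xi_j-\xi_k)}}\cdot\frac{1-qe^{-i(\xi_j+\xi_k)}}{1-e^{-i(\xi_j+\xi_k)}},$$ and for $\mu\in\Lambda$ let $$P_\mu(\boldsymbol{\xi})=\sum_{\sigma\in S_n,\ \epsilon\in\{1,-1\}^n}C(\epsilon_1\xi_{\sigma_1},\ldots,\epsilon_n\xi_{\sigma_n})\,e^{i\epsilon_1\xi_{\sigma_1}\mu_1+\cdots+i\epsilon_n\xi_{\sigma_n}\mu_n},\qquad \delta_\mu=\prod_{\substack{1\leq j<k\leq n\\ \mu_j=\mu_k}}\frac{1-q^{k-j}}{1-q^{1+k-j}}$$ be the hyperoctahedral Hall--Littlewood polynomial and its weight. Then for every $\lambda\in\Lambda$ the Christoffel weight $$\Delta_\lambda:=|C(\boldsymbol{\xi}_\lambda)|^2\Bigl(\sum_{\mu\in\Lambda}|P_\mu(\boldsymbol{\xi}_\lambda)|^2\,\delta_\mu\Bigr)^{-1}$$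 of the corresponding cubature rule for the circular quaternion ensemble satisfies $$\Delta_\lambda=\frac{1}{\det H(\boldsymbol{\xi}_\lambda)}.$$ -/

import Mathlib

open scoped BigOperators

namespace HyperoctahedralHL

/-! ### The Morse function and its minimum -/

/-- `u_q(θ) = (1 - q²) / (1 - 2 q cos θ + q²)`. -/
noncomputable def u (q θ : ℝ) : ℝ := (1 - q ^ 2) / (1 - 2 * q * Real.cos θ + q ^ 2)

/-- `v_q(ϑ) = ∫₀^ϑ u_q(θ) dθ`. -/
noncomputable def v (q θ : ℝ) : ℝ := ∫ t in (0 : ℝ)..θ, u q t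

/-- `ϱ_j = n + 1 - j` for `j = 1, …, n`; the index `j : Fin n` starts at `0`. -/
def rho {n : ℕ} (j : Fin n) : ℝ := (n : ℝ) - (j : ℝ)

/-- The Morse function `V_λ^{(m,n)} : ℝⁿ → ℝ` with parameters `q, q₀, q₁`. -/
noncomputable def morse {n : ℕ} (m : ℕ) (q q₀ q₁ : ℝ) (lam : Fin n → ℤ) (ξ : Fin n → ℝ) : ℝ :=
  (∑ j, ∑ k ∈ Finset.Ioi j,
    ((∫ t in (0 : ℝ)..(ξ j + ξ k), v q t) + ∫ t in (0 : ℝ)..(ξ j - ξ k), v q t))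
  + ∑ j, (((m : ℝ) + 1) * ξ j ^ 2 - 2 * Real.pi * (rho j + (lam j : ℝ)) * ξ j
      + ∫ t in (0 : ℝ)..(ξ j), (v q₀ t + v q₁ t))

/-- The Hessian matrix of the Morse function: the second partial derivatives `∂_j ∂_k V`.
The explicit formula is `hessian_apply` below. -/
noncomputable def hessian {n : ℕ} (m : ℕ) (q q₀ q₁ : ℝ) (lam : Fin n → ℤ) (ξ : Fin n → ℝ) :
    Matrix (Fin n) (Fin n) ℝ :=
  Matrix.of fun j k =>
    lineDeriv ℝ (fun η => lineDeriv ℝ (morse m q q₀ q₁ lam) η (Pi.single k 1)) ξ (Pi.single j 1)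

/-- The node `ξ_λ^{(m,n)}`: the global minimum of the Morse function, which exists and is unique
for parameters in `(-1, 1)` (`isMinOn_morse_iff` below). -/
noncomputable def node {n : ℕ} (m : ℕ) (q q₀ q₁ : ℝ) (lam : Fin n → ℤ) : Fin n → ℝ :=
  Classical.epsilon fun ξ => IsMinOn (morse m q q₀ q₁ lam) Set.univ ξ

/-! ### Hyperoctahedral Hall-Littlewood polynomials and Christoffel weights -/

/-- The finite alcove `{μ ∈ ℤⁿ : m ≥ μ₁ ≥ ⋯ ≥ μₙ ≥ 0}`. -/
noncomputable def alcove (m n : ℕ) : Finset (Fin n → ℤ) :=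
  open Classical in
  (Fintype.piFinset fun _ : Fin n => Finset.Icc (0 : ℤ) m).filter fun μ => Antitone μ

/-- The function `C(ξ; q, q₀)`. -/
noncomputable def C {n : ℕ} (q q₀ : ℝ) (ξ : Fin n → ℝ) : ℂ :=
  (∏ j, (1 - (q₀ : ℂ) * Complex.exp (-Complex.I * ξ j)) / (1 - Complex.exp (-2 * Complex.I * ξ j)))
  * ∏ j, ∏ k ∈ Finset.Ioi j,
      ((1 - (q : ℂ) * Complex.exp (-Complex.I * (ξ j - ξ k)))
          / (1 - Complex.exp (-Complex.I * (ξ j - ξ k)))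
        * ((1 - (q : ℂ) * Complex.exp (-Complex.I * (ξ j + ξ k)))
          / (1 - Complex.exp (-Complex.I * (ξ j + ξ k)))))

/-- The signed permutation `(ε₁ ξ_{σ₁}, …, εₙ ξ_{σₙ})` of `ξ`. -/
def signedPerm {n : ℕ} (σ : Equiv.Perm (Fin n)) (ε : Fin n → ℤˣ) (ξ : Fin n → ℝ) : Fin n → ℝ :=
  fun j => ((ε j : ℤ) : ℝ) * ξ (σ j)

/-- The hyperoctahedral Hall-Littlewood polynomial `P_μ(ξ; q, q₀)`. -/
noncomputable def P {n : ℕ} (q q₀ : ℝ) (μ : Fin n → ℤ) (ξ : Fin n → ℝ) : ℂ :=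
  ∑ σ : Equiv.Perm (Fin n), ∑ ε : Fin n → ℤˣ,
    C q q₀ (signedPerm σ ε ξ)
      * Complex.exp (Complex.I * ∑ j, ((signedPerm σ ε ξ j : ℝ) : ℂ) * (μ j : ℂ))

/-- The weight `δ_μ(q) = ∏_{j < k, μ_j = μ_k} (1 - q^{k-j}) / (1 - q^{1+k-j})`. -/
noncomputable def delta {n : ℕ} (q : ℝ) (μ : Fin n → ℤ) : ℝ :=
  ∏ j, ∏ k ∈ (Finset.Ioi j).filter fun k => μ j = μ k,
    (1 - q ^ ((k : ℕ) - (j : ℕ))) / (1 - q ^ (1 + ((k : ℕ) - (j : ℕ))))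

/-- The Christoffel weight of the Hall-Littlewood cubature rule at the node of `λ`. -/
noncomputable def christoffelHat {n : ℕ} (m : ℕ) (q q₀ q₁ : ℝ) (lam : Fin n → ℤ) : ℝ :=
  (∑ μ ∈ alcove m n, ‖P q q₀ μ (node m q q₀ q₁ lam)‖ ^ 2 * delta q μ)⁻¹

/-- The Christoffel weight of the cubature rule in the circular quaternion ensemble. -/
noncomputable def christoffel {n : ℕ} (m : ℕ) (q q₀ q₁ : ℝ) (lam : Fin n → ℤ) : ℝ :=
  ‖C q q₀ (node m q q₀ q₁ lam)‖ ^ 2 * christoffelHat m q q₀ q₁ lam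

/-! ### The node and the Hessian are well defined -/

theorem u_denom_pos {q : ℝ} (hq : q ∈ Set.Ioo (-1 : ℝ) 1) (θ : ℝ) :
    0 < 1 - 2 * q * Real.cos θ + q ^ 2 := by
  have h := Real.sin_sq_add_cos_sq θ
  have h1 : 0 < 1 - q ^ 2 := by nlinarith [hq.1, hq.2]
  by_cases hs : Real.sin θ = 0
  · have hc : Real.cos θ ^ 2 = 1 := by rw [hs] at h; linarith
    rcases sq_eq_one_iff.mp hc with hc | hc <;> rw [hc] <;> nlinarith [hq.1, hq.2]
  · have : 0 < Real.sin θ ^ 2 := by positivity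
    nlinarith [sq_nonneg (q - Real.cos θ)]

theorem u_pos {q : ℝ} (hq : q ∈ Set.Ioo (-1 : ℝ) 1) (θ : ℝ) : 0 < u q θ :=
  div_pos (by nlinarith [hq.1, hq.2]) (u_denom_pos hq θ)

theorem continuous_u {q : ℝ} (hq : q ∈ Set.Ioo (-1 : ℝ) 1) : Continuous (u q) :=
  Continuous.div (by fun_prop) (by fun_prop) fun θ => (u_denom_pos hq θ).ne'

theorem hasDerivAt_v {q : ℝ} (hq : q ∈ Set.Ioo (-1 : ℝ) 1) (θ : ℝ) :
    HasDerivAt (v q) (u q θ) θ :=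
  intervalIntegral.integral_hasDerivAt_right ((continuous_u hq).intervalIntegrable _ _)
    ((continuous_u hq).stronglyMeasurableAtFilter _ _) (continuous_u hq).continuousAt

theorem continuous_v {q : ℝ} (hq : q ∈ Set.Ioo (-1 : ℝ) 1) : Continuous (v q) :=
  continuous_iff_continuousAt.2 fun θ => (hasDerivAt_v hq θ).continuousAt

theorem monotone_v {q : ℝ} (hq : q ∈ Set.Ioo (-1 : ℝ) 1) : Monotone (v q) :=
  monotone_of_hasDerivAt_nonneg (hasDerivAt_v hq) fun θ => (u_pos hq θ).le

theorem v_zero (q : ℝ) : v q 0 = 0 := intervalIntegral.integral_same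

theorem hasDerivAt_integral_v {q : ℝ} (hq : q ∈ Set.Ioo (-1 : ℝ) 1) (x : ℝ) :
    HasDerivAt (fun x => ∫ t in (0 : ℝ)..x, v q t) (v q x) x :=
  intervalIntegral.integral_hasDerivAt_right ((continuous_v hq).intervalIntegrable _ _)
    ((continuous_v hq).stronglyMeasurableAtFilter _ _) (continuous_v hq).continuousAt

theorem continuous_integral_v {q : ℝ} (hq : q ∈ Set.Ioo (-1 : ℝ) 1) :
    Continuous (fun x => ∫ t in (0 : ℝ)..x, v q t) :=
  continuous_iff_continuousAt.2 fun x => (hasDerivAt_integral_v hq x).continuousAt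

theorem integral_v_nonneg {q : ℝ} (hq : q ∈ Set.Ioo (-1 : ℝ) 1) (x : ℝ) :
    0 ≤ ∫ t in (0 : ℝ)..x, v q t := by
  rcases le_total 0 x with hx | hx
  · exact intervalIntegral.integral_nonneg hx fun t ht => v_zero q ▸ monotone_v hq ht.1
  · rw [intervalIntegral.integral_symm, neg_nonneg]
    have := intervalIntegral.integral_nonneg (μ := MeasureTheory.volume) (f := fun t => -v q t) hx
      fun t ht => neg_nonneg.2 (v_zero q ▸ monotone_v hq ht.2)
    rw [intervalIntegral.integral_neg] at this
    linarith

theorem integral_v_midpoint {q : ℝ} (hq : q ∈ Set.Ioo (-1 : ℝ) 1) (x y : ℝ) :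
    2 * (∫ t in (0 : ℝ)..((x + y) / 2), v q t)
      ≤ (∫ t in (0 : ℝ)..x, v q t) + ∫ t in (0 : ℝ)..y, v q t := by
  have hd : deriv (fun x => ∫ t in (0 : ℝ)..x, v q t) = v q :=
    funext fun x => (hasDerivAt_integral_v hq x).deriv
  have hc : ConvexOn ℝ Set.univ (fun x => ∫ t in (0 : ℝ)..x, v q t) :=
    Monotone.convexOn_univ_of_deriv
      (fun x => (hasDerivAt_integral_v hq x).differentiableAt) (by rw [hd]; exact monotone_v hq)
  have h := hc.2 (Set.mem_univ x) (Set.mem_univ y) (by norm_num : (0 : ℝ) ≤ 1 / 2)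
    (by norm_num : (0 : ℝ) ≤ 1 / 2) (by norm_num)
  simp only [smul_eq_mul] at h
  rw [show (x + y) / 2 = 1 / 2 * x + 1 / 2 * y by ring]
  linarith

theorem morse_eq {n : ℕ} (m : ℕ) {q q₀ q₁ : ℝ} (hq₀ : q₀ ∈ Set.Ioo (-1 : ℝ) 1)
    (hq₁ : q₁ ∈ Set.Ioo (-1 : ℝ) 1) (lam : Fin n → ℤ) (ξ : Fin n → ℝ) :
    morse m q q₀ q₁ lam ξ =
      (∑ j, ∑ k ∈ Finset.Ioi j,
        ((∫ t in (0 : ℝ)..(ξ j + ξ k), v q t) + ∫ t in (0 : ℝ)..(ξ j - ξ k), v q t))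
      + ∑ j, (((m : ℝ) + 1) * ξ j ^ 2 - 2 * Real.pi * (rho j + (lam j : ℝ)) * ξ j
        + ((∫ t in (0 : ℝ)..(ξ j), v q₀ t) + ∫ t in (0 : ℝ)..(ξ j), v q₁ t)) := by
  unfold morse
  simp only [intervalIntegral.integral_add ((continuous_v hq₀).intervalIntegrable _ _)
    ((continuous_v hq₁).intervalIntegrable _ _)]

theorem continuous_morse {n : ℕ} (m : ℕ) {q q₀ q₁ : ℝ} (hq : q ∈ Set.Ioo (-1 : ℝ) 1)
    (hq₀ : q₀ ∈ Set.Ioo (-1 : ℝ) 1) (hq₁ : q₁ ∈ Set.Ioo (-1 : ℝ) 1) (lam : Fin n → ℤ) :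
    Continuous (morse m q q₀ q₁ lam) := by
  rw [funext (morse_eq (q := q) m hq₀ hq₁ lam)]
  have h := continuous_integral_v hq
  have h0 := continuous_integral_v hq₀
  have h1 := continuous_integral_v hq₁
  refine Continuous.add (continuous_finsetSum _ fun j _ => continuous_finsetSum _ fun k _ => ?_)
    (continuous_finsetSum _ fun j _ => ?_)
  · exact (h.comp (by fun_prop : Continuous fun ξ : Fin n → ℝ => ξ j + ξ k)).add
      (h.comp (by fun_prop : Continuous fun ξ : Fin n → ℝ => ξ j - ξ k))
  · exact Continuous.add (by fun_prop) ((h0.comp (continuous_apply j)).add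
      (h1.comp (continuous_apply j)))

theorem morse_lower {n : ℕ} (m : ℕ) {q q₀ q₁ : ℝ} (hq : q ∈ Set.Ioo (-1 : ℝ) 1)
    (hq₀ : q₀ ∈ Set.Ioo (-1 : ℝ) 1) (hq₁ : q₁ ∈ Set.Ioo (-1 : ℝ) 1) (lam : Fin n → ℤ)
    (ξ : Fin n → ℝ) :
    ‖ξ‖ - ∑ j, (1 + 2 * Real.pi * |rho j + (lam j : ℝ)|) ^ 2 ≤ morse m q q₀ q₁ lam ξ := by
  have hterm : ∀ (j : Fin n), |ξ j| - (1 + 2 * Real.pi * |rho j + (lam j : ℝ)|) ^ 2 ≤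
      ((m : ℝ) + 1) * ξ j ^ 2 - 2 * Real.pi * (rho j + (lam j : ℝ)) * ξ j
        + ((∫ t in (0 : ℝ)..(ξ j), v q₀ t) + ∫ t in (0 : ℝ)..(ξ j), v q₁ t) := by
    intro j
    have h0 := integral_v_nonneg hq₀ (ξ j)
    have h1 := integral_v_nonneg hq₁ (ξ j)
    have hm : 0 ≤ (m : ℝ) * ξ j ^ 2 := by positivity
    have hp := Real.pi_pos
    have habs : (rho j + (lam j : ℝ)) * ξ j ≤ |rho j + (lam j : ℝ)| * |ξ j| :=
      (le_abs_self _).trans (abs_mul _ _).le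
    have h2 := mul_le_mul_of_nonneg_left habs (by positivity : 0 ≤ 2 * Real.pi)
    have hsq : |ξ j| ^ 2 = ξ j ^ 2 := sq_abs _
    nlinarith [sq_nonneg (|ξ j| - (1 + 2 * Real.pi * |rho j + (lam j : ℝ)|)),
      sq_nonneg (1 + 2 * Real.pi * |rho j + (lam j : ℝ)|), sq_nonneg (|ξ j|)]
  have hnorm : ‖ξ‖ ≤ ∑ j, |ξ j| := by
    refine (pi_norm_le_iff_of_nonneg (Finset.sum_nonneg fun j _ => abs_nonneg _)).2 fun j => ?_
    exact Finset.single_le_sum (f := fun j => |ξ j|) (fun j _ => abs_nonneg _) (Finset.mem_univ j)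
  have hsum := Finset.sum_le_sum fun j (_ : j ∈ Finset.univ) => hterm j
  have hpair : 0 ≤ ∑ j, ∑ k ∈ Finset.Ioi j,
      ((∫ t in (0 : ℝ)..(ξ j + ξ k), v q t) + ∫ t in (0 : ℝ)..(ξ j - ξ k), v q t) :=
    Finset.sum_nonneg fun j _ => Finset.sum_nonneg fun k _ =>
      add_nonneg (integral_v_nonneg hq _) (integral_v_nonneg hq _)
  rw [Finset.sum_sub_distrib] at hsum
  rw [morse_eq m hq₀ hq₁]
  linarith

theorem exists_isMinOn_morse {n : ℕ} (m : ℕ) {q q₀ q₁ : ℝ} (hq : q ∈ Set.Ioo (-1 : ℝ) 1)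
    (hq₀ : q₀ ∈ Set.Ioo (-1 : ℝ) 1) (hq₁ : q₁ ∈ Set.Ioo (-1 : ℝ) 1) (lam : Fin n → ℤ) :
    ∃ ξ, IsMinOn (morse m q q₀ q₁ lam) Set.univ ξ := by
  have ht : Filter.Tendsto (morse m q q₀ q₁ lam) (Filter.cocompact _) Filter.atTop := by
    refine Filter.tendsto_atTop_mono (morse_lower m hq hq₀ hq₁ lam) ?_
    exact Filter.tendsto_atTop_add_const_right _ _ (tendsto_norm_cocompact_atTop)
  obtain ⟨ξ, hξ⟩ := (continuous_morse m hq hq₀ hq₁ lam).exists_forall_le ht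
  exact ⟨ξ, fun η _ => hξ η⟩

theorem morse_midpoint {n : ℕ} (m : ℕ) {q q₀ q₁ : ℝ} (hq : q ∈ Set.Ioo (-1 : ℝ) 1)
    (hq₀ : q₀ ∈ Set.Ioo (-1 : ℝ) 1) (hq₁ : q₁ ∈ Set.Ioo (-1 : ℝ) 1) (lam : Fin n → ℤ)
    (ξ η : Fin n → ℝ) :
    2 * morse m q q₀ q₁ lam (fun j => (ξ j + η j) / 2) + (1 / 2) * ∑ j, (ξ j - η j) ^ 2
      ≤ morse m q q₀ q₁ lam ξ + morse m q q₀ q₁ lam η := by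
  have hadd : ∀ A B A₁ B₁ A₂ B₂ D : ℝ, 2 * A ≤ A₁ + A₂ → 2 * B + 1 / 2 * D ≤ B₁ + B₂ →
      2 * (A + B) + 1 / 2 * D ≤ (A₁ + B₁) + (A₂ + B₂) := fun A B A₁ B₁ A₂ B₂ D h h' => by linarith
  simp only [morse_eq m hq₀ hq₁]
  refine hadd _ _ _ _ _ _ _ ?_ ?_
  · simp only [Finset.mul_sum, ← Finset.sum_add_distrib]
    refine Finset.sum_le_sum fun j _ => Finset.sum_le_sum fun k _ => ?_
    have h1 := integral_v_midpoint hq (ξ j + ξ k) (η j + η k)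
    have h2 := integral_v_midpoint hq (ξ j - ξ k) (η j - η k)
    rw [show (ξ j + η j) / 2 + (ξ k + η k) / 2 = (ξ j + ξ k + (η j + η k)) / 2 by ring,
      show (ξ j + η j) / 2 - (ξ k + η k) / 2 = (ξ j - ξ k + (η j - η k)) / 2 by ring]
    linarith
  · simp only [Finset.mul_sum, ← Finset.sum_add_distrib]
    refine Finset.sum_le_sum fun j _ => ?_
    have h0 := integral_v_midpoint hq₀ (ξ j) (η j)
    have h1 := integral_v_midpoint hq₁ (ξ j) (η j)
    have hm : 0 ≤ (m : ℝ) * (ξ j - η j) ^ 2 := by positivity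
    nlinarith

theorem isMinOn_morse_unique {n : ℕ} (m : ℕ) {q q₀ q₁ : ℝ} (hq : q ∈ Set.Ioo (-1 : ℝ) 1)
    (hq₀ : q₀ ∈ Set.Ioo (-1 : ℝ) 1) (hq₁ : q₁ ∈ Set.Ioo (-1 : ℝ) 1) (lam : Fin n → ℤ)
    {ξ η : Fin n → ℝ} (hξ : IsMinOn (morse m q q₀ q₁ lam) Set.univ ξ)
    (hη : IsMinOn (morse m q q₀ q₁ lam) Set.univ η) : ξ = η := by
  have h := morse_midpoint m hq hq₀ hq₁ lam ξ η
  have h1 := isMinOn_iff.1 hξ (fun j => (ξ j + η j) / 2) (Set.mem_univ _)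
  have h2 := isMinOn_iff.1 hη (fun j => (ξ j + η j) / 2) (Set.mem_univ _)
  have hz : ∑ j, (ξ j - η j) ^ 2 = 0 :=
    le_antisymm (by linarith) (Finset.sum_nonneg fun j _ => sq_nonneg (ξ j - η j))
  funext j
  have := (Finset.sum_eq_zero_iff_of_nonneg (f := fun j => (ξ j - η j) ^ 2)
    fun j _ => sq_nonneg (ξ j - η j)).1 hz j (Finset.mem_univ j)
  exact sub_eq_zero.1 (pow_eq_zero_iff (two_ne_zero) |>.1 this)

/-- The node is the unique global minimum of the Morse function. -/
theorem isMinOn_morse_iff {n : ℕ} (m : ℕ) {q q₀ q₁ : ℝ} (hq : q ∈ Set.Ioo (-1 : ℝ) 1)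
    (hq₀ : q₀ ∈ Set.Ioo (-1 : ℝ) 1) (hq₁ : q₁ ∈ Set.Ioo (-1 : ℝ) 1) (lam : Fin n → ℤ)
    (ξ : Fin n → ℝ) :
    IsMinOn (morse m q q₀ q₁ lam) Set.univ ξ ↔ ξ = node m q q₀ q₁ lam := by
  have hn : IsMinOn (morse m q q₀ q₁ lam) Set.univ (node m q q₀ q₁ lam) :=
    Classical.epsilon_spec (exists_isMinOn_morse m hq hq₀ hq₁ lam)
  exact ⟨fun h => isMinOn_morse_unique m hq hq₀ hq₁ lam h hn, fun h => h ▸ hn⟩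

theorem lineDeriv_morse {n : ℕ} (m : ℕ) {q q₀ q₁ : ℝ} (hq : q ∈ Set.Ioo (-1 : ℝ) 1)
    (hq₀ : q₀ ∈ Set.Ioo (-1 : ℝ) 1) (hq₁ : q₁ ∈ Set.Ioo (-1 : ℝ) 1) (lam : Fin n → ℤ)
    (ξ x : Fin n → ℝ) :
    lineDeriv ℝ (morse m q q₀ q₁ lam) ξ x =
      (∑ j, ∑ k ∈ Finset.Ioi j,
        (v q (ξ j + ξ k) * (x j + x k) + v q (ξ j - ξ k) * (x j - x k)))
      + ∑ j, (2 * ((m : ℝ) + 1) * ξ j - 2 * Real.pi * (rho j + (lam j : ℝ))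
        + (v q₀ (ξ j) + v q₁ (ξ j))) * x j := by
  have hc : ∀ j, HasDerivAt (fun t : ℝ => (ξ + t • x) j) (x j) 0 := fun j => by
    simpa using ((hasDerivAt_id (0 : ℝ)).mul_const (x j)).const_add (ξ j)
  refine HasLineDerivAt.lineDeriv ?_
  rw [funext (morse_eq (q := q) m hq₀ hq₁ lam)]
  refine HasDerivAt.add (HasDerivAt.fun_sum fun j _ => HasDerivAt.fun_sum fun k _ => ?_)
    (HasDerivAt.fun_sum fun j _ => ?_)
  · have h1 := (hasDerivAt_integral_v hq _).comp (0 : ℝ) ((hc j).add (hc k))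
    have h2 := (hasDerivAt_integral_v hq _).comp (0 : ℝ) ((hc j).sub (hc k))
    refine (h1.add h2).congr_deriv ?_
    simp
  · have h1 := (hasDerivAt_integral_v hq₀ _).comp (0 : ℝ) (hc j)
    have h2 := (hasDerivAt_integral_v hq₁ _).comp (0 : ℝ) (hc j)
    refine HasDerivAt.congr_deriv (((((hc j).pow 2).const_mul ((m : ℝ) + 1)).sub
      ((hc j).const_mul (2 * Real.pi * (rho j + (lam j : ℝ))))).add (h1.add h2)) ?_
    simp
    ring

theorem lineDeriv_lineDeriv_morse {n : ℕ} (m : ℕ) {q q₀ q₁ : ℝ} (hq : q ∈ Set.Ioo (-1 : ℝ) 1)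
    (hq₀ : q₀ ∈ Set.Ioo (-1 : ℝ) 1) (hq₁ : q₁ ∈ Set.Ioo (-1 : ℝ) 1) (lam : Fin n → ℤ)
    (ξ x y : Fin n → ℝ) :
    lineDeriv ℝ (fun η => lineDeriv ℝ (morse m q q₀ q₁ lam) η x) ξ y =
      (∑ j, ∑ k ∈ Finset.Ioi j,
        (u q (ξ j + ξ k) * (y j + y k) * (x j + x k)
          + u q (ξ j - ξ k) * (y j - y k) * (x j - x k)))
      + ∑ j, (2 * ((m : ℝ) + 1) + u q₀ (ξ j) + u q₁ (ξ j)) * y j * x j := by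
  have hc : ∀ j, HasDerivAt (fun t : ℝ => (ξ + t • y) j) (y j) 0 := fun j => by
    simpa using ((hasDerivAt_id (0 : ℝ)).mul_const (y j)).const_add (ξ j)
  refine HasLineDerivAt.lineDeriv ?_
  simp only [lineDeriv_morse m hq hq₀ hq₁]
  refine HasDerivAt.add (HasDerivAt.fun_sum fun j _ => HasDerivAt.fun_sum fun k _ => ?_)
    (HasDerivAt.fun_sum fun j _ => ?_)
  · have h1 := (hasDerivAt_v hq _).comp (0 : ℝ) ((hc j).add (hc k))
    have h2 := (hasDerivAt_v hq _).comp (0 : ℝ) ((hc j).sub (hc k))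
    refine ((h1.mul_const (x j + x k)).add (h2.mul_const (x j - x k))).congr_deriv ?_
    simp
  · have h1 := (hasDerivAt_v hq₀ _).comp (0 : ℝ) (hc j)
    have h2 := (hasDerivAt_v hq₁ _).comp (0 : ℝ) (hc j)
    refine HasDerivAt.congr_deriv (((((hc j).const_mul (2 * ((m : ℝ) + 1))).sub_const
      (2 * Real.pi * (rho j + (lam j : ℝ)))).add (h1.add h2)).mul_const (x j)) ?_
    simp only [zero_smul, add_zero]
    ring

theorem u_neg (q θ : ℝ) : u q (-θ) = u q θ := by simp [u]

theorem two_mul_sum_Ioi {n : ℕ} (f : Fin n → Fin n → ℝ) (hf : ∀ j k, f j k = f k j) :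
    2 * ∑ j, ∑ k ∈ Finset.Ioi j, f j k = ∑ j, ∑ k ∈ Finset.univ.erase j, f j k := by
  have h1 : ∀ j : Fin n, ∑ k ∈ Finset.univ.erase j, f j k
      = ∑ k, (if j < k then f j k else 0) + ∑ k, (if k < j then f j k else 0) := by
    intro j
    rw [← Finset.sum_add_distrib, ← Finset.sum_erase_add _ _ (Finset.mem_univ j)]
    simp only [lt_self_iff_false, if_false, add_zero]
    refine Finset.sum_congr rfl fun k hk => ?_
    rcases lt_or_gt_of_ne (Finset.ne_of_mem_erase hk) with h | h <;> simp [h, h.not_gt]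
  have h2 : ∀ j : Fin n, ∑ k ∈ Finset.Ioi j, f j k = ∑ k, (if j < k then f j k else 0) := by
    intro j
    rw [← Finset.sum_filter]
    exact Finset.sum_congr (by ext; simp) fun _ _ => rfl
  simp only [h1, h2, Finset.sum_add_distrib]
  rw [Finset.sum_comm (f := fun j k => if k < j then f j k else 0), two_mul]
  simp only [hf]

/-- The explicit form of the Hessian. -/
theorem hessian_apply {n : ℕ} (m : ℕ) {q q₀ q₁ : ℝ} (hq : q ∈ Set.Ioo (-1 : ℝ) 1)
    (hq₀ : q₀ ∈ Set.Ioo (-1 : ℝ) 1) (hq₁ : q₁ ∈ Set.Ioo (-1 : ℝ) 1) (lam : Fin n → ℤ)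
    (ξ : Fin n → ℝ) (j k : Fin n) :
    hessian m q q₀ q₁ lam ξ j k =
      if k = j then
        2 * ((m : ℝ) + 1) + u q₀ (ξ j) + u q₁ (ξ j)
          + ∑ l ∈ Finset.univ.erase j, (u q (ξ j + ξ l) + u q (ξ j - ξ l))
      else u q (ξ j + ξ k) - u q (ξ j - ξ k) := by
  have hsymm : ∀ a b, u q (ξ a - ξ b) = u q (ξ b - ξ a) := fun a b => by
    rw [← u_neg, neg_sub]
  set y : Fin n → ℝ := Pi.single j 1 with hy
  set x : Fin n → ℝ := Pi.single k 1 with hx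
  have hstep := two_mul_sum_Ioi (fun a b =>
      u q (ξ a + ξ b) * (y a + y b) * (x a + x b) + u q (ξ a - ξ b) * (y a - y b) * (x a - x b))
    fun a b => by rw [hsymm a b, add_comm (ξ a)]; ring
  have herase : ∀ (a : Fin n) (g : Fin n → ℝ),
      ∑ b ∈ Finset.univ.erase a, g b = ∑ b, g b - g a := fun a g => by
    rw [← Finset.sum_erase_add _ _ (Finset.mem_univ a)]; ring
  have e1 : ∀ G : Fin n → Fin n → ℝ, ∑ a, ∑ b, G a b * (y a * x b) = G j k := fun G => by
    simp [hx, hy, Pi.single_apply]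
  have e2 : ∀ G : Fin n → ℝ, ∑ a, G a * (y a * x a) = if k = j then G j else 0 := fun G => by
    by_cases h : k = j
    · subst h; simp [hx, hy, Pi.single_apply]
    · simp [hx, hy, Pi.single_apply, h]
  have hsplit : ∑ a, ∑ b, (u q (ξ a + ξ b) * (y a + y b) * (x a + x b)
        + u q (ξ a - ξ b) * (y a - y b) * (x a - x b))
      = 2 * ∑ a, (∑ b, (u q (ξ a + ξ b) + u q (ξ a - ξ b))) * (y a * x a)
        + 2 * ∑ a, ∑ b, (u q (ξ a + ξ b) - u q (ξ a - ξ b)) * (y a * x b) := by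
    have h1 : ∑ a, ∑ b, (u q (ξ a + ξ b) + u q (ξ a - ξ b)) * (y b * x b)
        = ∑ a, ∑ b, (u q (ξ a + ξ b) + u q (ξ a - ξ b)) * (y a * x a) := by
      rw [Finset.sum_comm]
      refine Finset.sum_congr rfl fun a _ => Finset.sum_congr rfl fun b _ => ?_
      rw [hsymm a b, add_comm (ξ a)]
    have h2 : ∑ a, ∑ b, (u q (ξ a + ξ b) - u q (ξ a - ξ b)) * (y b * x a)
        = ∑ a, ∑ b, (u q (ξ a + ξ b) - u q (ξ a - ξ b)) * (y a * x b) := by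
      rw [Finset.sum_comm]
      refine Finset.sum_congr rfl fun a _ => Finset.sum_congr rfl fun b _ => ?_
      rw [hsymm a b, add_comm (ξ a)]
    simp only [Finset.sum_mul, two_mul]
    nth_rewrite 2 [← h1]
    nth_rewrite 2 [← h2]
    simp only [← Finset.sum_add_distrib]
    refine Finset.sum_congr rfl fun a _ => Finset.sum_congr rfl fun b _ => ?_
    ring
  have hdiag : ∑ a, (u q (ξ a + ξ a) * (y a + y a) * (x a + x a)
        + u q (ξ a - ξ a) * (y a - y a) * (x a - x a))
      = ∑ a, (4 * u q (ξ a + ξ a)) * (y a * x a) :=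
    Finset.sum_congr rfl fun a _ => by ring
  have hlast : ∑ a, (2 * ((m : ℝ) + 1) + u q₀ (ξ a) + u q₁ (ξ a)) * y a * x a
      = ∑ a, (2 * ((m : ℝ) + 1) + u q₀ (ξ a) + u q₁ (ξ a)) * (y a * x a) :=
    Finset.sum_congr rfl fun a _ => by ring
  rw [hessian, Matrix.of_apply, lineDeriv_lineDeriv_morse m hq hq₀ hq₁, hlast, e2]
  simp only [herase, Finset.sum_sub_distrib] at hstep ⊢
  rw [hsplit, hdiag, e1, e2, e2] at hstep
  by_cases hjk : k = j
  · subst hjk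
    simp only [if_true] at hstep ⊢
    linarith
  · simp only [hjk, if_false] at hstep ⊢
    linarith

end HyperoctahedralHL

/-!
Write `x_j = exp (i ξ_j)` at the node `ξ`. The gradient of the Morse function vanishes there, and
since `exp (i v_q(θ)) = (x - q) / (1 - q x)` for `x = exp (i θ)` (`phase_v`), exponentiating the
critical equations gives the Bethe equations: `x_j ^ (2 (m + 1))` times a product of such
scattering factors equals `1` (`bethe_of_node`). Monotonicity of `v_q` together with
`v_q(θ + 2π) = v_q(θ) + 2π` places the node in the open alcove `π > ξ₁ > ξ₂ > 0`
(`node_two_bounds`), so none of the denominators of `C` vanishes.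

For a solution of the Bethe equations the sum `∑ |P_μ|² δ_μ` is computed in closed form
(`sum_hallLittlewood_sq`). As `P_μ` is a sum over the hyperoctahedral group `W`, so is `P_μ²`;
modulo the common factor `|C|²` its summands are the images under `W` of one sum of eight monomials
in `μ` whose coefficients are products of scattering factors (`hallLittlewood_sq`). Summing these
monomials over the triangle `m ≥ μ₁ ≥ μ₂ ≥ 0` produces geometric sums, and the Bethe equations
eliminate the powers `x_j ^ (2 (m + 1))` (`diagTerm_eq`). What remains is to symmetrise:

* the odd powers `x₁ ^ (m + 1) * x₂ ^ (± (m + 1))` cancel because the scattering factors of `x₁`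
  and `x₂` with the same parameter `q₀` satisfy an algebraic relation (`scat_relation`,
  `weylSum_termOdd`);
* the geometric sum of ratio `(x₁ x₂)²` must not be divided by `(x₁ x₂)² - 1`, as `ξ₁ + ξ₂ = π` is
  possible; its symmetrised coefficient is itself divisible by `1 - (x₁ x₂)²` (`residue_eq`), which
  makes up for the missing division;
* the terms in the scattering factors of `q₀` and those in the scattering factors of `q₁` have
  the same coefficients, up to inversion (`weylSum_linCoeffInv`, `pairCoeff_inv_add`), and both
  reduce, by the relation above, to Poisson kernels (`weylSum_linCoeff`).

The Poisson kernel `u_q(θ)` is the `θ`-derivative of `v_q(θ)`, and for `x = exp (i θ)` it equals the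
difference of the scattering factor and its inverse, divided by `x - x⁻¹` (`poisson_eq`). The
outcome is the determinant of the Hessian. In one variable the same computation takes a few lines
(`sum_shortFactor_sq`).
-/

namespace HyperoctahedralHL

open Finset

/-! ### Scattering factors and Poisson kernels -/

section Algebra

variable {K : Type*} [Field K]

/-- The scattering factor `(x - p) / (1 - p x)`; on the unit circle it is `exp (i v_p(θ))`. -/
def scat (p x : K) : K := (x - p) / (1 - p * x)

/-- The Poisson kernel as a rational function; at `x = exp (i θ)` it is `u_p(θ)`. -/
def poisson (p x : K) : K := (1 - p ^ 2) * x / ((1 - p * x) * (x - p))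

/-- The coefficient `1 / (1 + q) - a / (a - 1)` that multiplies the geometric sum of ratio `a b` in the sum
of `a ^ μ₁ * b ^ μ₂` over the weighted triangle (`triSum_of_left_ne_one`), over one denominator. -/
def kappa (q a : K) : K := -(1 + q * a) / ((1 + q) * (a - 1))

theorem ne_zero_of_mul_eq {a b c : K} (h : a * b = c) (hc : c ≠ 0) : a ≠ 0 := by
  rintro rfl; exact hc (by rw [← h, zero_mul])

theorem inv_sub_ne_zero {p x : K} (hx : x ≠ 0) (h : 1 - p * x ≠ 0) : x⁻¹ - p ≠ 0 :=
  ne_zero_of_mul_eq (b := x) (by field_simp) h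

theorem one_sub_inv_ne_zero {p x : K} (hx : x ≠ 0) (h : x - p ≠ 0) : 1 - p * x⁻¹ ≠ 0 :=
  ne_zero_of_mul_eq (b := x) (by field_simp) h

theorem div_inv_sq_sub_one {x : K} (hx : x ≠ 0) (hx1 : x ^ 2 - 1 ≠ 0) :
    x⁻¹ / (x⁻¹ ^ 2 - 1) = -(x / (x ^ 2 - 1)) := by
  have : 1 - x ^ 2 ≠ 0 := fun e => hx1 (by linear_combination -e)
  field_simp
  ring

theorem scat_inv {p x : K} (hx : x ≠ 0) (h1 : 1 - p * x ≠ 0) (h2 : x - p ≠ 0) :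
    scat p x⁻¹ = (scat p x)⁻¹ := by
  unfold scat
  have : 1 - p * x⁻¹ ≠ 0 := by
    intro h; apply h2
    rw [show x - p = x * (1 - p * x⁻¹) by field_simp, h, mul_zero]
  field_simp

/-- Scattering factors with a common parameter are algebraically dependent over the points: this is
what makes the boundary reflections at `x` and at `y` compatible. -/
theorem scat_relation {p x y : K} (hx1 : 1 - p * x ≠ 0) (hy1 : 1 - p * y ≠ 0) :
    (scat p x - scat p y) * (x * y - 1) = (scat p x * scat p y - 1) * (x - y) := by
  unfold scat
  rw [div_sub_div _ _ hx1 hy1, div_mul_div_comm, div_sub_one (mul_ne_zero hx1 hy1)]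
  ring

theorem poisson_inv {q z : K} (hz : z ≠ 0) (h1 : 1 - q * z ≠ 0) (h2 : z - q ≠ 0) :
    poisson q z⁻¹ = poisson q z := by
  have h3 : 1 - q * z⁻¹ ≠ 0 := one_sub_inv_ne_zero hz h2
  have h4 : z⁻¹ - q ≠ 0 := inv_sub_ne_zero hz h1
  unfold poisson
  rw [div_eq_div_iff (mul_ne_zero h3 h4) (mul_ne_zero h1 h2)]
  field_simp

/-- The Poisson kernel is linear in the scattering factor and its inverse. -/
theorem poisson_eq {p x : K} (hx : x ≠ 0) (hx1 : x ^ 2 - 1 ≠ 0) (h1 : 1 - p * x ≠ 0)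
    (h2 : x - p ≠ 0) :
    poisson p x = (scat p x - (scat p x)⁻¹) * (x / (x ^ 2 - 1)) := by
  unfold scat poisson
  field_simp
  ring

theorem kappa_inv {q a : K} (hq : 1 + q ≠ 0) (ha : a ≠ 0) (h : a - 1 ≠ 0) :
    kappa q a⁻¹ = 1 / (1 + q) + 1 / (a - 1) := by
  have h' : 1 - a ≠ 0 := fun h0 => h (by linear_combination -h0)
  unfold kappa
  field_simp
  ring

theorem scat_mul_kappa_add {q z : K} (hq : 1 + q ≠ 0) (hz : z ≠ 0) (hz1 : z - 1 ≠ 0) (h1 : 1 - q * z ≠ 0)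
    (h2 : z - q ≠ 0) :
    (1 - q) / (1 + q) - (scat q z * kappa q z + (scat q z)⁻¹ * kappa q z⁻¹) = 2 * poisson q z := by
  rw [kappa_inv hq hz hz1]
  unfold scat kappa poisson
  have h1' : 1 - z * q ≠ 0 := by rwa [mul_comm]
  field_simp
  ring1

/-! ### Geometric sums over the triangle -/

/-- The sum of `a ^ l` over `0 ≤ l ≤ m`. -/
def geom (m : ℕ) (a : K) : K := ∑ l ∈ range (m + 1), a ^ l

/-- The sum of `a ^ l * b ^ k` over the triangle `m ≥ l ≥ k ≥ 0`, with weight `t` on the diagonal. For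
`t = 1 / (1 + q)` the weight is `δ_μ`. -/
def triSum (m : ℕ) (t a b : K) : K :=
  ∑ l ∈ range (m + 1), (∑ k ∈ range l, a ^ l * b ^ k + t * (a ^ l * b ^ l))

theorem geom_mul (m : ℕ) (a : K) : geom m a * (a - 1) = a ^ (m + 1) - 1 :=
  geom_sum_mul a (m + 1)

theorem geom_eq (m : ℕ) {a : K} (ha : a ≠ 1) : geom m a = (a ^ (m + 1) - 1) / (a - 1) :=
  eq_div_of_mul_eq (sub_ne_zero.2 ha) (geom_mul m a)

theorem geom_one (m : ℕ) : geom m (1 : K) = m + 1 := by simp [geom]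

theorem geom_succ (m : ℕ) (a : K) : geom (m + 1) a = geom m a + a ^ (m + 1) :=
  sum_range_succ _ _

theorem triSum_succ (m : ℕ) (t a b : K) :
    triSum (m + 1) t a b = triSum m t a b + (a ^ (m + 1) * geom m b + t * (a * b) ^ (m + 1)) := by
  rw [triSum, sum_range_succ, ← mul_sum, mul_pow]; rfl

theorem triSum_mul_left (m : ℕ) (t a b : K) :
    triSum m t a b * (a - 1)
      = a ^ (m + 1) * geom m b - a * geom m (a * b) + (a - 1) * t * geom m (a * b) := by
  induction m with
  | zero => simp [triSum, geom]; ring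
  | succ m ih => rw [triSum_succ, geom_succ, geom_succ, add_mul, ih]; ring

theorem triSum_mul_right (m : ℕ) (t a b : K) :
    triSum m t a b * (b - 1)
      = geom m (a * b) - geom m a + (b - 1) * t * geom m (a * b) := by
  induction m with
  | zero => simp [triSum, geom]; ring
  | succ m ih =>
    rw [triSum_succ, geom_succ, geom_succ, add_mul, ih]
    linear_combination a ^ (m + 1) * geom_mul m b

theorem two_mul_triSum_one (m : ℕ) (t : K) :
    2 * triSum m t 1 1 = (m + 1) * m + 2 * t * (m + 1) := by
  induction m with
  | zero => simp [triSum]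
  | succ m ih =>
    rw [triSum_succ, mul_add, ih, geom_one]; push_cast; ring

/-- The value of the triangular sum when `a ≠ 1`. The sum `geom m (a * b)` is kept unevaluated, since
`a * b = 1` is allowed. -/
theorem triSum_of_left_ne_one (m : ℕ) {q a : K} (hq : 1 + q ≠ 0) (ha : a ≠ 1) (b : K) :
    triSum m (1 / (1 + q)) a b = a ^ (m + 1) * geom m b / (a - 1) + kappa q a * geom m (a * b) := by
  have h := triSum_mul_left m (1 / (1 + q)) a b
  have ha' := sub_ne_zero.2 ha
  rw [kappa, eq_comm, ← sub_eq_zero]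
  have : ∀ T : K, T * (a - 1) = a ^ (m + 1) * geom m b - a * geom m (a * b)
      + (a - 1) * (1 / (1 + q)) * geom m (a * b) →
      a ^ (m + 1) * geom m b / (a - 1) + -(1 + q * a) / ((1 + q) * (a - 1)) * geom m (a * b) - T
        = 0 := by
    intro T hT
    rw [eq_div_of_mul_eq ha' hT]
    field_simp
    ring
  exact this _ h

theorem triSum_one_left (m : ℕ) {q b : K} (hq : 1 + q ≠ 0) (hb : b ≠ 1) :
    triSum m (1 / (1 + q)) 1 b = (geom m b - (m + 1)) / (b - 1) + 1 / (1 + q) * geom m b := by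
  have h := triSum_mul_right m (1 / (1 + q)) 1 b
  have hb' := sub_ne_zero.2 hb
  rw [eq_div_of_mul_eq hb' h, geom_one, one_mul]
  field_simp

/-! ### Generic points and Bethe points -/

/-- The denominators that occur at the point `(x, y)` and at its images under the hyperoctahedral group
do not vanish. The poles of the coefficients are excluded, but `(x y)² = 1` and `(x / y)² = 1` are
not excluded entirely: `x y = -1` and `x = -y` are allowed. -/
structure Generic (q x y : K) : Prop where
  x0 : x ≠ 0
  y0 : y ≠ 0
  q1 : 1 + q ≠ 0
  x1 : x ^ 2 - 1 ≠ 0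
  y1 : y ^ 2 - 1 ≠ 0
  xy : x * y - 1 ≠ 0
  x_y : x - y ≠ 0
  qxy : 1 - q * (x * y) ≠ 0
  xyq : x * y - q ≠ 0
  xqy : x - q * y ≠ 0
  yqx : y - q * x ≠ 0

theorem Generic.swap {q x y : K} (h : Generic q x y) : Generic q y x where
  x0 := h.y0
  y0 := h.x0
  q1 := h.q1
  x1 := h.y1
  y1 := h.x1
  xy := by rw [mul_comm]; exact h.xy
  x_y := by rw [← neg_sub, neg_ne_zero]; exact h.x_y
  qxy := by rw [mul_comm y]; exact h.qxy
  xyq := by rw [mul_comm y]; exact h.xyq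
  xqy := h.yqx
  yqx := h.xqy

theorem Generic.inv {q x y : K} (h : Generic q x y) : Generic q x⁻¹ y where
  x0 := inv_ne_zero h.x0
  y0 := h.y0
  q1 := h.q1
  x1 := ne_zero_of_mul_eq (b := -x ^ 2) (by have := h.x0; field_simp; ring) h.x1
  y1 := h.y1
  xy := ne_zero_of_mul_eq (b := -x) (by have := h.x0; field_simp; ring) h.x_y
  x_y := ne_zero_of_mul_eq (b := -x) (by have := h.x0; field_simp; ring) h.xy
  qxy := ne_zero_of_mul_eq (b := x) (by have := h.x0; field_simp) h.xqy
  xyq := ne_zero_of_mul_eq (b := x) (by have := h.x0; field_simp) h.yqx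
  xqy := ne_zero_of_mul_eq (b := x) (by have := h.x0; field_simp) h.qxy
  yqx := ne_zero_of_mul_eq (b := x) (by have := h.x0; field_simp) h.xyq

/-- The same denominators with terms in another order or with the opposite sign, in the shapes in
which they arise when fractions are cleared. -/
theorem Generic.denom_ne_zero {q x y : K} (h : Generic q x y) :
    1 - x * y * q ≠ 0 ∧ x - y * q ≠ 0 ∧ y - x * q ≠ 0 ∧ 1 - x ^ 2 ≠ 0 ∧ 1 - y ^ 2 ≠ 0 ∧
      1 - x * y ≠ 0 ∧ y - x ≠ 0 := by
  refine ⟨fun e => h.qxy ?_, fun e => h.xqy ?_, fun e => h.yqx ?_, fun e => h.x1 ?_,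
    fun e => h.y1 ?_, fun e => h.xy ?_, fun e => h.x_y ?_⟩ <;>
  first | linear_combination e | linear_combination -e

theorem Generic.scat_div {q x y : K} (h : Generic q x y) :
    scat q (y / x) = (scat q (x / y))⁻¹ := by
  obtain ⟨hx, hy, hq, hx1, hy1, hxy, hx_y, h1, h2, h3, h4⟩ := h
  rw [← scat_inv (div_ne_zero hx hy), inv_div]
  · exact ne_zero_of_mul_eq (b := y) (by field_simp) h4
  · exact ne_zero_of_mul_eq (b := y) (by field_simp) h3

theorem Generic.scat_mul_inv {q x y : K} (h : Generic q x y) :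
    scat q (x⁻¹ * y⁻¹) = (scat q (x * y))⁻¹ := by
  rw [← scat_inv (mul_ne_zero h.x0 h.y0) h.qxy h.xyq, mul_inv]

theorem Generic.poisson_div {q x y : K} (h : Generic q x y) :
    poisson q (y / x) = poisson q (x / y) := by
  obtain ⟨hx, hy, hq, hx1, hy1, hxy, hx_y, h1, h2, h3, h4⟩ := h
  rw [← inv_div, poisson_inv (div_ne_zero hx hy)]
  · exact ne_zero_of_mul_eq (b := y) (by field_simp) h4
  · exact ne_zero_of_mul_eq (b := y) (by field_simp) h3

/-- A generic point that satisfies the Bethe equations at level `m` and is not a zero or pole of the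
scattering factors with parameters `q₀` and `q₁`. -/
structure Bethe (m : ℕ) (q q₀ q₁ x y : K) : Prop where
  gen : Generic q x y
  x0 : 1 - q₀ * x ≠ 0
  x0' : x - q₀ ≠ 0
  y0 : 1 - q₀ * y ≠ 0
  y0' : y - q₀ ≠ 0
  x1 : 1 - q₁ * x ≠ 0
  x1' : x - q₁ ≠ 0
  y1 : 1 - q₁ * y ≠ 0
  y1' : y - q₁ ≠ 0
  eqx : (x ^ 2) ^ (m + 1) * (scat q₀ x * scat q₁ x * scat q (x * y) * scat q (x / y)) = 1
  eqy : (y ^ 2) ^ (m + 1) * (scat q₀ y * scat q₁ y * scat q (y * x) * scat q (y / x)) = 1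

theorem Bethe.swap {m : ℕ} {q q₀ q₁ x y : K} (h : Bethe m q q₀ q₁ x y) : Bethe m q q₀ q₁ y x :=
  ⟨h.gen.swap, h.y0, h.y0', h.x0, h.x0', h.y1, h.y1', h.x1, h.x1', h.eqy, h.eqx⟩

theorem Bethe.inv {m : ℕ} {q q₀ q₁ x y : K} (h : Bethe m q q₀ q₁ x y) :
    Bethe m q q₀ q₁ x⁻¹ y where
  gen := h.gen.inv
  x0 := one_sub_inv_ne_zero h.gen.x0 h.x0'
  x0' := inv_sub_ne_zero h.gen.x0 h.x0
  y0 := h.y0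
  y0' := h.y0'
  x1 := one_sub_inv_ne_zero h.gen.x0 h.x1'
  x1' := inv_sub_ne_zero h.gen.x0 h.x1
  y1 := h.y1
  y1' := h.y1'
  eqx := by
    rw [scat_inv h.gen.x0 h.x0 h.x0', scat_inv h.gen.x0 h.x1 h.x1', inv_mul_eq_div x y,
      h.gen.scat_div, div_eq_mul_inv x⁻¹, h.gen.scat_mul_inv, inv_pow, inv_pow, ← mul_inv, ← mul_inv,
      ← mul_inv, ← mul_inv, inv_eq_one]
    linear_combination h.eqx
  eqy := by
    rw [← div_eq_mul_inv, div_inv_eq_mul]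
    linear_combination h.eqy

/-- The Bethe equations force all scattering factors to be nonzero. -/
theorem Bethe.scat_ne {m : ℕ} {q q₀ q₁ x y : K} (h : Bethe m q q₀ q₁ x y) :
    scat q₀ x ≠ 0 ∧ scat q₁ x ≠ 0 ∧ scat q (x * y) ≠ 0 ∧ scat q (x / y) ≠ 0 := by
  have := right_ne_zero_of_mul (h.eqx ▸ one_ne_zero)
  simp only [mul_ne_zero_iff] at this
  tauto

/-! ### Sums over the hyperoctahedral group -/

/-- The sum of `f` over the orbit of `(x, y)` under the hyperoctahedral group of order eight. -/
def weylSum (f : K → K → K) (x y : K) : K :=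
  f x y + f y x + f x⁻¹ y + f y x⁻¹ + f x y⁻¹ + f y⁻¹ x + f x⁻¹ y⁻¹ + f y⁻¹ x⁻¹

/-- The sum of `f` over the four sign changes `x ↦ x⁻¹`, `y ↦ y⁻¹`. -/
def signSum (f : K → K → K) (x y : K) : K := f x y + f x⁻¹ y + f x y⁻¹ + f x⁻¹ y⁻¹

theorem weylSum_add (f g : K → K → K) (x y : K) :
    weylSum (fun u v => f u v + g u v) x y = weylSum f x y + weylSum g x y := by
  unfold weylSum; ring

theorem weylSum_swap (f : K → K → K) (x y : K) : weylSum f y x = weylSum f x y := by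
  unfold weylSum; ring

theorem weylSum_inv (f : K → K → K) (x y : K) : weylSum f x⁻¹ y = weylSum f x y := by
  unfold weylSum; simp only [inv_inv]; ring

theorem weylSum_inv_right (f : K → K → K) (x y : K) :
    weylSum (fun u v => f u v⁻¹) x y = weylSum f x y := by
  unfold weylSum
  simp only [inv_inv]
  ring

/-- Collecting the coefficients of the values of a function of one variable in a sum over the group. -/
theorem weylSum_mul_add_mul (f : K → K) (g₁ g₂ : K → K → K) (x y : K) :
    weylSum (fun u v => f u * g₁ u v + f v * g₂ u v) x y
      = f x * (g₁ x y + g₁ x y⁻¹ + g₂ y x + g₂ y⁻¹ x)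
        + f y * (g₁ y x + g₁ y x⁻¹ + g₂ x y + g₂ x⁻¹ y)
        + f x⁻¹ * (g₁ x⁻¹ y + g₁ x⁻¹ y⁻¹ + g₂ y x⁻¹ + g₂ y⁻¹ x⁻¹)
        + f y⁻¹ * (g₁ y⁻¹ x + g₁ y⁻¹ x⁻¹ + g₂ x y⁻¹ + g₂ x⁻¹ y⁻¹) := by
  unfold weylSum; ring

/-- A sum over the group can be evaluated by adding, at every Bethe point, the values of `f` at the
point and at its transpose. -/
theorem weylSum_eq_signSum {m : ℕ} {q q₀ q₁ : K} {f g : K → K → K} {x y : K}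
    (h : Bethe m q q₀ q₁ x y) (hfg : ∀ u v, Bethe m q q₀ q₁ u v → f u v + f v u = g u v) :
    weylSum f x y = signSum g x y := by
  unfold weylSum signSum
  linear_combination hfg x y h + hfg x⁻¹ y h.inv + hfg x y⁻¹ h.swap.inv.swap +
    hfg x⁻¹ y⁻¹ h.swap.inv.swap.inv

theorem weylSum_congr {m : ℕ} {q q₀ q₁ : K} {f g : K → K → K} {x y : K}
    (h : Bethe m q q₀ q₁ x y) (hfg : ∀ u v, Bethe m q q₀ q₁ u v → f u v = g u v) :
    weylSum f x y = weylSum g x y := by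
  rw [weylSum_eq_signSum (g := fun u v => g u v + g v u) h fun u v h' => by
    rw [hfg u v h', hfg v u h'.swap]]
  unfold weylSum signSum
  ring

/-! ### The coefficients and their rational identities -/

/-- The coefficient of the product of the two scattering factors with parameter `q₀`, after
symmetrisation and after removal of the part that occurs in the determinant of the Hessian. -/
def pairCoeff (q x y : K) : K :=
  x * y / ((x ^ 2 - 1) * (y ^ 2 - 1)) *
    ((x - y) ^ 2 * (x * y - q) * ((1 + q) * (1 + q * (x * y) ^ 2) - q * (x + y) ^ 2)
      / ((1 - q * (x * y)) * (y - q * x) * (x - q * y) * (x * y - 1) ^ 2) - 1)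

/-- The quotient by `1 - (x y)²` of the symmetrised coefficient of the geometric sum of ratio `(x y)²`;
see `residue_eq`. -/
def resCoeff (q x y : K) : K :=
  (x - y) ^ 2 * ((1 + q) * (1 + q * (x * y) ^ 2) - q * (x + y) ^ 2)
      / ((y - q * x) * (x - q * y) * (x ^ 2 - 1) * (y ^ 2 - 1) * (x * y - 1) ^ 2)

/-- The coefficient of the scattering factor of `x` with parameter `q₀`, before symmetrisation. -/
def linCoeffFst (q x y : K) : K :=
  x / (x ^ 2 - 1) * (scat q (x / y) * scat q (x * y) * kappa q (x ^ 2) - scat q (x / y) * kappa q (x / y))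

/-- The coefficient of the scattering factor of `y` with parameter `q₀`, before symmetrisation. -/
def linCoeffSnd (q x y : K) : K :=
  y / (y ^ 2 - 1) * (kappa q (y ^ 2)⁻¹ - scat q (x * y) * kappa q (x * y))

/-- The coefficient of the inverse scattering factor of `x` with parameter `q₁`, before symmetrisation. -/
def linCoeffInvFst (q x y : K) : K :=
  x / (x ^ 2 - 1) * (kappa q (x / y) / scat q (x * y) - kappa q (x ^ 2))
    + x * y / ((x - y) * (x * y - 1)) / scat q (x * y)

/-- The coefficient of the inverse scattering factor of `y` with parameter `q₁`, before symmetrisation. -/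
def linCoeffInvSnd (q x y : K) : K :=
  y / (y ^ 2 - 1) * (scat q (x / y) * kappa q (x * y)
    - scat q (x / y) / scat q (x * y) * kappa q (y ^ 2)⁻¹)
    - x * y / ((x - y) * (x * y - 1)) * scat q (x / y)

theorem pairCoeff_swap (q x y : K) : pairCoeff q x y = pairCoeff q y x := by
  unfold pairCoeff; rw [mul_comm y x]; congr 1
  · ring
  · congr 2 <;> ring

/-- The symmetrised coefficient of the geometric sum of ratio `(x y)²` is divisible by `1 - (x y)²`, so
that this sum can be eliminated even where `x y = -1`. -/
theorem residue_eq {q x y : K} (h : Generic q x y) :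
    scat q (x / y) * kappa q (x ^ 2) - kappa q (x * y) + (scat q (y / x) * kappa q (y ^ 2) - kappa q (y * x))
      = (1 - (x * y) ^ 2) * resCoeff q x y := by
  obtain ⟨h1', h3', h4', k1, k2, k3, k4⟩ := h.denom_ne_zero
  obtain ⟨hx, hy, hq, hx1, hy1, hxy, hx_y, h1, h2, h3, h4⟩ := h
  unfold scat kappa resCoeff
  rw [mul_comm y x]
  field_simp
  ring1

theorem pairCoeff_add {q x y : K} (h : Generic q x y) :
    x * y * resCoeff q x y * scat q (x * y)
    = pairCoeff q x y + x * y / ((x ^ 2 - 1) * (y ^ 2 - 1)) := by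
  obtain ⟨h1', h3', h4', k1, k2, k3, k4⟩ := h.denom_ne_zero
  obtain ⟨hx, hy, hq, hx1, hy1, hxy, hx_y, h1, h2, h3, h4⟩ := h
  unfold scat pairCoeff resCoeff
  field_simp
  ring1

/-- The coefficient of the product of the inverse scattering factors with parameter `q₁` is that of
the scattering factors with parameter `q₀`, taken at the inverse point. -/
theorem pairCoeff_inv_add {q x y : K} (h : Generic q x y) :
    x * y / ((x ^ 2 - 1) * (y ^ 2 - 1)) * (scat q (x / y) + scat q (y / x)) / scat q (x * y)
      - 2 * (x * y / (x * y - 1) ^ 2) / scat q (x * y)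
      - x * y * resCoeff q x y / scat q (x * y)
    = pairCoeff q x⁻¹ y⁻¹ + x * y / ((x ^ 2 - 1) * (y ^ 2 - 1)) := by
  obtain ⟨h1', h3', h4', k1, k2, k3, k4⟩ := h.denom_ne_zero
  obtain ⟨hx, hy, hq, hx1, hy1, hxy, hx_y, h1, h2, h3, h4⟩ := h
  unfold scat pairCoeff resCoeff
  field_simp
  ring1

set_option maxRecDepth 10000 in
/-- The coefficient of the scattering factor of `x` in the symmetrised sum. -/
theorem sum_linCoeff {q x y : K} (h : Generic q x y) :
    linCoeffFst q x y + linCoeffFst q x y⁻¹ + linCoeffSnd q y x + linCoeffSnd q y⁻¹ x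
      = x / (x ^ 2 - 1) * (poisson q (x * y) + poisson q (x / y))
        - pairCoeff q x y * (x * y - 1) / (x - y) - pairCoeff q x y⁻¹ * (x - y) / (x * y - 1) := by
  obtain ⟨h1', h3', h4', k1, k2, k3, k4⟩ := h.denom_ne_zero
  obtain ⟨hx, hy, hq, hx1, hy1, hxy, hx_y, h1, h2, h3, h4⟩ := h
  unfold linCoeffFst linCoeffSnd scat kappa pairCoeff poisson
  field_simp
  ring1

set_option maxRecDepth 10000 in
/-- The right-hand side is that of `sum_linCoeff` at `(x⁻¹, y)`. -/
theorem sum_linCoeffInv {q x y : K} (h : Generic q x y) :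
    linCoeffInvFst q x y + linCoeffInvFst q x y⁻¹ + linCoeffInvSnd q y x + linCoeffInvSnd q y⁻¹ x
      = -(x / (x ^ 2 - 1)) * (poisson q (x * y) + poisson q (x / y))
        - pairCoeff q x⁻¹ y * (x - y) / (x * y - 1)
        - pairCoeff q x⁻¹ y⁻¹ * (x * y - 1) / (x - y) := by
  obtain ⟨h1', h3', h4', k1, k2, k3, k4⟩ := h.denom_ne_zero
  obtain ⟨hx, hy, hq, hx1, hy1, hxy, hx_y, h1, h2, h3, h4⟩ := h
  have h1'' : 1 - x * q * y ≠ 0 := by convert h1 using 1; ring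
  unfold linCoeffInvFst linCoeffInvSnd scat kappa pairCoeff poisson
  field_simp
  ring1

/-- The terms that remain free of `q₀`, `q₁` and `m`. The right-hand side is
`(A + B) ^ 2 - (A - B) ^ 2` for the Poisson kernels `A` at `x y` and `B` at `x / y`, as it occurs in the
determinant. -/
theorem signSum_pairCoeff {q x y : K} (h : Generic q x y) :
    2 * signSum (pairCoeff q) x y
      + signSum (fun u v => (scat q (u / v) + scat q (v / u)) * (u * v / (u - v) ^ 2)) x y
    = 4 * poisson q (x * y) * poisson q (x / y) := by
  obtain ⟨h1', h3', h4', k1, k2, k3, k4⟩ := h.denom_ne_zero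
  obtain ⟨hx, hy, hq, hx1, hy1, hxy, hx_y, h1, h2, h3, h4⟩ := h
  unfold signSum scat pairCoeff poisson
  field_simp
  ring1

/-! ### Evaluation of the summed monomials at a Bethe point -/

/-- The sum of the products of `C(x, y)` with `C(w)` at the eight images `w` of `(x, y)`, relative to
`C(x, y) * C(x⁻¹, y⁻¹)`, each multiplied by `T (x * w₁) (y * w₂)`. -/
def crossTerm (q q₀ : K) (T : K → K → K) (x y : K) : K :=
  T 1 1 - scat q (x / y) * T (x / y) (y / x)
    - y * scat q₀ y * T 1 (y ^ 2)
    - x * scat q₀ x * scat q (x / y) * scat q (x * y) * T (x ^ 2) 1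
    + x * scat q₀ x * (y * scat q₀ y) * scat q (x / y) * scat q (x * y) * T (x ^ 2) (y ^ 2)
    - x * scat q₀ x * (y * scat q₀ y) * scat q (x * y) * T (x * y) (x * y)
    + x * scat q₀ x * scat q (x / y) * T (x / y) (x * y)
    + y * scat q₀ y * scat q (x * y) * T (x * y) (y / x)

/-- The sum of the eight monomials over the weighted triangle. -/
def diagTerm (m : ℕ) (q q₀ x y : K) : K :=
  crossTerm q q₀ (triSum m (1 / (1 + q))) x y

/-- The terms of `diagTerm` proportional to `m + 1`. -/
def termM (m : ℕ) (q q₀ q₁ x y : K) : K :=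
  (m + 1) * (y / (y ^ 2 - 1) * scat q₀ y - x / (x ^ 2 - 1) * (scat q₁ x)⁻¹
    - scat q (x / y) * kappa q (x / y))

/-- The terms of `diagTerm` that are odd in `x ^ (m + 1)` and in `y ^ (m + 1)`. -/
def termOdd (m : ℕ) (q q₀ x y : K) : K :=
  -(x * y / (x - y) ^ 2) * scat q (x / y) * (x ^ (m + 1) / y ^ (m + 1))
  + x * y / (x * y - 1) ^ 2 * scat q₀ x * scat q₀ y * scat q (x * y) * (x ^ (m + 1) * y ^ (m + 1))
  - x * y / ((x - y) * (x * y - 1)) * scat q₀ x * scat q (x / y) * (x ^ (m + 1) / y ^ (m + 1))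
  + x * y / ((x - y) * (x * y - 1)) * scat q₀ y * scat q (x * y) * (x ^ (m + 1) * y ^ (m + 1))

/-- The terms of `diagTerm` with the geometric sum of ratio `(x y)²`. -/
def termPair (m : ℕ) (q q₀ x y : K) : K :=
  x * y * scat q₀ x * scat q₀ y * scat q (x * y) * (scat q (x / y) * kappa q (x ^ 2) - kappa q (x * y))
    * geom m ((x * y) ^ 2)

/-- The terms of `diagTerm` without `m` that involve none or two of the scattering factors with
parameters `q₀` and `q₁`. -/
def termRest (q q₀ q₁ x y : K) : K :=
  x * y / ((x ^ 2 - 1) * (y ^ 2 - 1)) *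
    (scat q (x / y) / scat q (x * y) * (scat q₁ x)⁻¹ * (scat q₁ y)⁻¹ - scat q₀ y * (scat q₁ x)⁻¹)
  + scat q (x / y) * (x * y / (x - y) ^ 2)
  - x * y / (x * y - 1) ^ 2 * ((scat q₁ x)⁻¹ * (scat q₁ y)⁻¹ / scat q (x * y))

/-- The Bethe equations replace `x ^ (2 (m + 1))` and `y ^ (2 (m + 1))` by inverse scattering factors,
and `diagTerm` is sorted by its dependence on `m`, `q₀` and `q₁`. -/
theorem diagTerm_eq {m : ℕ} {q q₀ q₁ x y : K} (h : Bethe m q q₀ q₁ x y) :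
    diagTerm m q q₀ x y = triSum m (1 / (1 + q)) 1 1
      + termM m q q₀ q₁ x y + termOdd m q q₀ x y
      + (scat q₀ x * linCoeffFst q x y + scat q₀ y * linCoeffSnd q x y)
      + ((scat q₁ x)⁻¹ * linCoeffInvFst q x y + (scat q₁ y)⁻¹ * linCoeffInvSnd q x y)
      + termPair m q q₀ x y + termRest q q₀ q₁ x y := by
  obtain ⟨ha1, hb1, hs, hr⟩ := h.scat_ne
  obtain ⟨ha2, hb2, -, -⟩ := h.swap.scat_ne
  have hB1 := h.eqx
  have hB2 := h.eqy
  rw [h.gen.scat_div, mul_comm y x] at hB2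
  obtain ⟨hx, hy, hq, hx1, hy1, hxy, hx_y, -, -, -, -⟩ := h.gen
  have hX : x ^ (m + 1) ≠ 0 := pow_ne_zero _ hx
  have hY : y ^ (m + 1) ≠ 0 := pow_ne_zero _ hy
  have e1 : x / y ≠ 1 := fun h => hx_y (by rw [div_eq_one_iff_eq hy] at h; rw [h, sub_self])
  have e1' : y / x ≠ 1 := fun h => hx_y (by rw [div_eq_one_iff_eq hx] at h; rw [h, sub_self])
  have e2 : x * y ≠ 1 := sub_ne_zero.1 hxy
  have e3 : x ^ 2 ≠ 1 := sub_ne_zero.1 hx1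
  have e4 : y ^ 2 ≠ 1 := sub_ne_zero.1 hy1
  have e5 : x / y * (y / x) = 1 := by field_simp
  have e6 : x / y * (x * y) = x ^ 2 := by field_simp
  have e7 : x * y * (y / x) = y ^ 2 := by field_simp
  unfold diagTerm crossTerm termM termOdd termPair termRest linCoeffFst linCoeffInvFst linCoeffSnd linCoeffInvSnd
  simp only [triSum_of_left_ne_one m hq e1, triSum_of_left_ne_one m hq e2,
    triSum_of_left_ne_one m hq e3, triSum_one_left m hq e4, e5, e6, e7, mul_one, ← mul_pow, ← sq,
    geom_one, geom_eq m e1', geom_eq m e2, geom_eq m e3, geom_eq m e4, kappa_inv hq (pow_ne_zero 2 hy) hy1]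
  generalize kappa q (x / y) = k1, kappa q (x * y) = k2, kappa q (x ^ 2) = k3
  generalize geom m ((x * y) ^ 2) = g, triSum m (1 / (1 + q)) 1 1 = t0
  generalize scat q₀ x = a1, scat q₀ y = a2, scat q₁ x = b1, scat q₁ y = b2,
    scat q (x * y) = s, scat q (x / y) = r at *
  rw [← pow_mul, mul_comm 2, pow_mul] at hB1 hB2
  simp only [div_pow, mul_pow, ← pow_mul x, ← pow_mul y, mul_comm 2]
  simp only [pow_mul]
  generalize x ^ (m + 1) = X at *
  generalize y ^ (m + 1) = Y at *
  -- the Bethe equations, solved for the scattering factors with parameter `q₁`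
  have hb1' : b1⁻¹ = X ^ 2 * (a1 * s * r) :=
    inv_eq_of_mul_eq_one_right ( by linear_combination hB1)
  have hb2' : b2⁻¹ = Y ^ 2 * (a2 * s / r) :=
    inv_eq_of_mul_eq_one_right ( by linear_combination hB2)
  rw [hb1', hb2', div_sub_one hy, div_sub_one hx, show y - x = -(x - y) by ring]
  clear hb1' hb2' hB1 hB2 e1 e1' e2 e3 e4 e5 e6 e7
  generalize x - y = d, x * y - 1 = e, x ^ 2 - 1 = f1, y ^ 2 - 1 = f2, (1 : K) / (1 + q) = t at *
  field_simp
  ring1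

/-! ### Symmetrisation -/

theorem weylSum_termM {m : ℕ} {q q₀ q₁ x y : K} (h : Bethe m q q₀ q₁ x y) :
    8 * triSum m (1 / (1 + q)) 1 1 + weylSum (termM m q q₀ q₁) x y
      = 4 * (m + 1) ^ 2
        + (m + 1) * (2 * (x / (x ^ 2 - 1) * (scat q₀ x - (scat q₀ x)⁻¹ + (scat q₁ x - (scat q₁ x)⁻¹))
          + y / (y ^ 2 - 1) * (scat q₀ y - (scat q₀ y)⁻¹ + (scat q₁ y - (scat q₁ y)⁻¹)))
          + 4 * (poisson q (x * y) + poisson q (x / y))) := by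
  have k1 := scat_mul_kappa_add h.gen.q1 (mul_ne_zero h.gen.x0 h.gen.y0) h.gen.xy h.gen.qxy h.gen.xyq
  have k2 := scat_mul_kappa_add (q := q) (z := x / y) h.gen.q1 (div_ne_zero h.gen.x0 h.gen.y0)
    (by rw [div_sub_one h.gen.y0]; exact div_ne_zero h.gen.x_y h.gen.y0)
    (ne_zero_of_mul_eq (b := y) (by have := h.gen.y0; field_simp) h.gen.yqx)
    (ne_zero_of_mul_eq (b := y) (by have := h.gen.y0; field_simp) h.gen.xqy)
  rw [inv_div] at k2
  rw [mul_inv] at k1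
  have ht := two_mul_triSum_one m (1 / (1 + q))
  have hq : (1 - q) / (1 + q) = 2 * (1 / (1 + q)) - 1 := by
    have := h.gen.q1; field_simp; ring
  rw [hq] at k1 k2
  have s1 := h.gen.scat_div
  have s2 := h.gen.scat_mul_inv
  have ex := div_inv_sq_sub_one h.gen.x0 h.gen.x1
  have ey := div_inv_sq_sub_one h.gen.y0 h.gen.y1
  unfold weylSum termM
  simp only [ex, ey, scat_inv h.gen.x0 h.x0 h.x0', scat_inv h.gen.x0 h.x1 h.x1',
      scat_inv h.gen.y0 h.y0 h.y0', scat_inv h.gen.y0 h.y1 h.y1', inv_inv,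
      div_inv_eq_mul, div_eq_mul_inv x⁻¹, div_eq_mul_inv y⁻¹]
  simp only [inv_mul_eq_div x y, inv_mul_eq_div y x, mul_comm y x, mul_comm y⁻¹ x⁻¹, s1, s2]
  linear_combination 4 * ht + 2 * (m + 1) * k1 + 2 * (m + 1) * k2

/-- The odd powers cancel in pairs by `scat_relation`. -/
theorem weylSum_termOdd {m : ℕ} {q q₀ q₁ x y : K} (h : Bethe m q q₀ q₁ x y) :
    weylSum (termOdd m q q₀) x y = 0 := by
  have e : termOdd m q q₀ = fun u v =>
      -(scat q (u / v) * (u ^ (m + 1) / v ^ (m + 1)) *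
        (u * v / (u - v) ^ 2 + u * v / ((u - v) * (u * v - 1)) * scat q₀ u))
      + scat q (u * v) * (u ^ (m + 1) * v ^ (m + 1)) *
        (u * v / (u * v - 1) ^ 2 * (scat q₀ u * scat q₀ v)
          + u * v / ((u - v) * (u * v - 1)) * scat q₀ v) := by
    funext u v; unfold termOdd; ring
  -- move all terms to the powers `x ^ (m + 1) / y ^ (m + 1)`; they then cancel pointwise
  rw [e, weylSum_add, ← weylSum_inv_right (fun u v => scat q (u * v) * (u ^ (m + 1) * v ^ (m + 1)) *
        (u * v / (u * v - 1) ^ 2 * (scat q₀ u * scat q₀ v)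
          + u * v / ((u - v) * (u * v - 1)) * scat q₀ v)), ← weylSum_add,
    weylSum_congr (g := fun _ _ => 0) h]
  · simp [weylSum]
  intro u v h
  have hrel := scat_relation h.x0 h.y0
  rw [scat_inv h.gen.y0 h.y0 h.y0', ← div_eq_mul_inv u v, inv_pow]
  have hv := h.swap.scat_ne.1
  obtain ⟨hx, hy, -, -, -, hxy, hx_y, -, -, -, -⟩ := h.gen
  rw [div_sub_one hy, show u - v⁻¹ = (u * v - 1) / v by field_simp]
  generalize scat q₀ u = a at *
  generalize scat q₀ v = b at *
  generalize scat q (u / v) = r at *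
  have hY : v ^ (m + 1) ≠ 0 := pow_ne_zero _ hy
  generalize v ^ (m + 1) = Y at *
  generalize u ^ (m + 1) = X at *
  generalize hd : u - v = d at *
  generalize he : u * v - 1 = e at *
  field_simp
  linear_combination (r * X * u * v) * hrel

/-- For a function `f` with the properties of a scattering factor, the linear and bilinear terms in `f`
reduce to Poisson kernels up to a term that does not involve `f`. -/
theorem weylSum_linCoeff {q x y : K} (h : Generic q x y) (f : K → K)
    (hfx : f x⁻¹ = (f x)⁻¹) (hfy : f y⁻¹ = (f y)⁻¹) (hx0 : f x ≠ 0) (hy0 : f y ≠ 0)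
    (hf : (f x - f y) * (x * y - 1) = (f x * f y - 1) * (x - y)) :
    weylSum (fun u v => f u * linCoeffFst q u v + f v * linCoeffSnd q u v) x y
      + signSum (fun u v => f u * f v * pairCoeff q u v) x y
    = (x / (x ^ 2 - 1) * (f x - (f x)⁻¹) + y / (y ^ 2 - 1) * (f y - (f y)⁻¹))
        * (poisson q (x * y) + poisson q (x / y)) + signSum (pairCoeff q) x y := by
  rw [weylSum_mul_add_mul, sum_linCoeff h, sum_linCoeff h.swap, sum_linCoeff h.inv,
    sum_linCoeff h.swap.inv]
  have P1 := h.poisson_div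
  have P3 := poisson_inv (mul_ne_zero h.x0 h.y0) h.qxy h.xyq
  rw [mul_inv] at P3
  obtain ⟨hx, hy, hq, hx1, hy1, hxy, hx_y, h1, h2, h3, h4⟩ := h
  -- inverting one variable inverts the ratio `(x y - 1) / (x - y)`
  have p1 : (x⁻¹ * y - 1) / (x⁻¹ - y) = (x - y) / (x * y - 1) := by
    rw [inv_mul_eq_div, div_sub_one hx, show x⁻¹ - y = -(x * y - 1) / x by field_simp; ring]
    field_simp; ring
  have p2 : (x⁻¹ - y) / (x⁻¹ * y - 1) = (x * y - 1) / (x - y) := by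
    rw [← inv_div, p1, inv_div]
  have p3 : (y⁻¹ * x - 1) / (y⁻¹ - x) = (y - x) / (y * x - 1) := by
    rw [inv_mul_eq_div, div_sub_one hy, show y⁻¹ - x = -(x * y - 1) / y by field_simp; ring,
      mul_comm y x]
    field_simp; ring
  have p4 : (y⁻¹ - x) / (y⁻¹ * x - 1) = (y * x - 1) / (y - x) := by
    rw [← inv_div, p3, inv_div]
  rw [mul_comm y x, ← neg_sub x y, div_neg] at p4
  rw [mul_comm y x, ← neg_sub x y, neg_div] at p3
  unfold signSum
  simp only [mul_div_assoc (pairCoeff _ _ _), p1, p2, p3, p4]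
  simp only [div_inv_sq_sub_one hx hx1,
    div_inv_sq_sub_one hy hy1, hfx, hfy, inv_mul_eq_div x y, inv_mul_eq_div y x, div_eq_mul_inv x⁻¹, div_eq_mul_inv y⁻¹, P3,
    P1, mul_comm y x, mul_comm y⁻¹ x⁻¹, ← neg_sub x y, div_neg, neg_div]
  rw [pairCoeff_swap q y x, pairCoeff_swap q y x⁻¹, pairCoeff_swap q y⁻¹ x,
    pairCoeff_swap q y⁻¹ x⁻¹]
  generalize poisson q (x * y) = A, poisson q (x / y) = B, pairCoeff q x y = E1,
    pairCoeff q x⁻¹ y = E2, pairCoeff q x y⁻¹ = E3, pairCoeff q x⁻¹ y⁻¹ = E4 at *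
  generalize f x = a, f y = b at *
  have g1 : (a - b) * ((x * y - 1) / (x - y)) = a * b - 1 := by
    rw [← mul_div_assoc, hf, mul_div_cancel_right₀ _ hx_y]
  have g2 : (a * b - 1) * ((x - y) / (x * y - 1)) = a - b := by
    rw [← mul_div_assoc, ← hf, mul_div_cancel_right₀ _ hxy]
  generalize (x * y - 1) / (x - y) = p at *
  generalize (x - y) / (x * y - 1) = p' at *
  generalize x / (x ^ 2 - 1) = c
  generalize y / (y ^ 2 - 1) = d
  have ha := mul_inv_cancel₀ hx0
  have hb := mul_inv_cancel₀ hy0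
  generalize a⁻¹ = a' at *
  generalize b⁻¹ = b' at *
  -- the relation `hf` at the images of `(x, y)` under sign changes
  have g3 : (a - b') * p' = a * b' - 1 := by
    linear_combination b' * g2 - (1 + p' * a) * hb
  have g4 : (a' - b) * p' = a' * b - 1 := by
    linear_combination -a' * g2 + (b * p' - 1) * ha
  have g5 : (a' - b') * p = a' * b' - 1 := by
    linear_combination -a' * b' * g1 + (b' * p - 1 - (b' * b-1)) * ha + (-a' * p - 1) * hb
  linear_combination -E1 * g1 - E2 * g4 - E3 * g3 - E4 * g5

/-- The linear terms for the parameter `q₁` are the same as those for `q₀`, with `f` in place of its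
inverse. -/
theorem weylSum_linCoeffInv {q x y : K} (h : Generic q x y) (f : K → K)
    (hfx : f x⁻¹ = (f x)⁻¹) (hfy : f y⁻¹ = (f y)⁻¹) :
    weylSum (fun u v => (f u)⁻¹ * linCoeffInvFst q u v + (f v)⁻¹ * linCoeffInvSnd q u v) x y
      = weylSum (fun u v => f u * linCoeffFst q u v + f v * linCoeffSnd q u v) x y := by
  have key : ∀ u v : K, Generic q u v →
      linCoeffInvFst q u v + linCoeffInvFst q u v⁻¹ + linCoeffInvSnd q v u + linCoeffInvSnd q v⁻¹ u
        = linCoeffFst q u⁻¹ v + linCoeffFst q u⁻¹ v⁻¹ + linCoeffSnd q v u⁻¹ + linCoeffSnd q v⁻¹ u⁻¹ := by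
    intro u v h
    have P1 := h.poisson_div
    have P3 := poisson_inv (mul_ne_zero h.x0 h.y0) h.qxy h.xyq
    rw [mul_inv] at P3
    rw [sum_linCoeffInv h, sum_linCoeff h.inv, div_inv_sq_sub_one h.x0 h.x1, div_eq_mul_inv u⁻¹ v,
      P3, inv_mul_eq_div u v, P1]
    obtain ⟨hx, hy, hq, hx1, hy1, hxy, hx_y, h1, h2, h3, h4⟩ := h
    have p1 : (v / u - 1) / (u⁻¹ - v) = (u - v) / (u * v - 1) := by
      rw [div_sub_one hx, show u⁻¹ - v = -(u * v - 1) / u by field_simp; ring]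
      field_simp; ring
    have p2 : (u⁻¹ - v) / (v / u - 1) = (u * v - 1) / (u - v) := by
      rw [← inv_div, p1, inv_div]
    simp only [mul_div_assoc (pairCoeff _ _ _), p1, p2]
    ring
  have k1 := key x y h
  have k2 := key y x h.swap
  have k3 := key x⁻¹ y h.inv
  have k4 := key y⁻¹ x h.swap.inv
  rw [weylSum_mul_add_mul (fun u => (f u)⁻¹), weylSum_mul_add_mul]
  simp only [inv_inv] at k3 k4
  simp only [hfx, hfy, inv_inv, k1, k2, k3, k4]
  ring

/-- The geometric sum in `termPair` is eliminated by `residue_eq` and the product of the two Bethe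
equations. -/
theorem weylSum_termPair_add_termRest {m : ℕ} {q q₀ q₁ x y : K} (h : Bethe m q q₀ q₁ x y) :
    weylSum (fun u v => termPair m q q₀ u v + termRest q q₀ q₁ u v) x y
    = signSum (fun u v => scat q₀ u * scat q₀ v * pairCoeff q u v) x y
      + signSum (fun u v => scat q₁ u * scat q₁ v * pairCoeff q u v) x y
      + x * y / ((x ^ 2 - 1) * (y ^ 2 - 1)) *
        ((scat q₀ x - (scat q₀ x)⁻¹ + (scat q₁ x - (scat q₁ x)⁻¹))
          * (scat q₀ y - (scat q₀ y)⁻¹ + (scat q₁ y - (scat q₁ y)⁻¹)))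
      + signSum (fun u v => (scat q (u / v) + scat q (v / u)) * (u * v / (u - v) ^ 2)) x y := by
  rw [weylSum_eq_signSum (g := fun u v => scat q₀ u * scat q₀ v *
      (pairCoeff q u v + u * v / ((u ^ 2 - 1) * (v ^ 2 - 1)))
      + (scat q₁ u)⁻¹ * (scat q₁ v)⁻¹ *
      (pairCoeff q u⁻¹ v⁻¹ + u * v / ((u ^ 2 - 1) * (v ^ 2 - 1)))
      - u * v / ((u ^ 2 - 1) * (v ^ 2 - 1)) *
        (scat q₀ v * (scat q₁ u)⁻¹ + scat q₀ u * (scat q₁ v)⁻¹)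
      + (scat q (u / v) + scat q (v / u)) * (u * v / (u - v) ^ 2)) h]
  · have ex := div_inv_sq_sub_one h.gen.x0 h.gen.x1
    have ey := div_inv_sq_sub_one h.gen.y0 h.gen.y1
    unfold signSum
    simp only [mul_div_mul_comm, ex, ey, scat_inv h.gen.x0 h.x0 h.x0', scat_inv h.gen.x0 h.x1 h.x1',
      scat_inv h.gen.y0 h.y0 h.y0', scat_inv h.gen.y0 h.y1 h.y1', inv_inv]
    ring
  intro u v h
  have i1 := pairCoeff_add h.gen
  have i2 := pairCoeff_inv_add h.gen
  have i3 := residue_eq h.gen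
  have hgeom := geom_mul m ((u * v) ^ 2)
  -- the product of the two Bethe equations
  have hB : ((u * v) ^ 2) ^ (m + 1) * (scat q₀ u * scat q₀ v * scat q₁ u * scat q₁ v
      * scat q (u * v) ^ 2) = 1 := by
    have e1 := h.eqx
    have e2 := h.eqy
    rw [h.gen.scat_div, mul_comm v u] at e2
    have hr := h.scat_ne.2.2.2
    rw [mul_pow, mul_pow]
    have := mul_inv_cancel₀ hr
    linear_combination e1 + (u ^ 2) ^ (m + 1) * (scat q₀ u * scat q₁ u * scat q (u * v) * scat q (u / v)) * e2
      - (u ^ 2) ^ (m + 1) * (v ^ 2) ^ (m + 1) * (scat q₀ u * scat q₀ v * scat q₁ u * scat q₁ v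
      * scat q (u * v) ^ 2) * this
  obtain ⟨ha1, hb1, hs, -⟩ := h.scat_ne
  obtain ⟨ha2, hb2, -, -⟩ := h.swap.scat_ne
  rw [← i1, ← i2]
  have hsum : termPair m q q₀ u v + termPair m q q₀ v u
      = -(u * v * resCoeff q u v * scat q (u * v)) *
        (((u * v) ^ 2) ^ (m + 1) * (scat q₀ u * scat q₀ v) - scat q₀ u * scat q₀ v) := by
    unfold termPair
    rw [mul_comm v u] at i3 ⊢
    linear_combination u * v * scat q₀ u * scat q₀ v * scat q (u * v) *
      (geom m ((u * v) ^ 2) * i3 - resCoeff q u v * hgeom)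
  have hB' : ((u * v) ^ 2) ^ (m + 1) * (scat q₀ u * scat q₀ v)
      = (scat q₁ u)⁻¹ * (scat q₁ v)⁻¹ / scat q (u * v) ^ 2 := by
    rw [eq_div_iff (pow_ne_zero 2 hs), ← mul_inv]
    exact eq_inv_of_mul_eq_one_left (by linear_combination hB)
  have hsq : (v - u) ^ 2 = (u - v) ^ 2 := by ring
  rw [add_add_add_comm, hsum, hB']
  unfold termRest
  rw [mul_comm v u, mul_comm (v ^ 2 - 1), hsq]
  field_simp
  ring

/-- The symmetrised sum is the determinant of the Hessian in terms of Poisson kernels. -/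
theorem weylSum_diagTerm {m : ℕ} {q q₀ q₁ x y : K} (h : Bethe m q q₀ q₁ x y) :
    weylSum (diagTerm m q q₀) x y
      = (2 * (m + 1) + poisson q₀ x + poisson q₁ x + (poisson q (x * y) + poisson q (x / y)))
          * (2 * (m + 1) + poisson q₀ y + poisson q₁ y + (poisson q (x * y) + poisson q (x / y)))
        - (poisson q (x * y) - poisson q (x / y)) ^ 2 := by
  rw [weylSum_congr h fun u v h' => diagTerm_eq h']
  have e0 : weylSum (fun _ _ => triSum m (1 / (1 + q)) 1 1) x y
      = 8 * triSum m (1 / (1 + q)) (1 : K) 1 := by unfold weylSum; ring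
  have e1 := weylSum_termM h
  have e2 := weylSum_termOdd h
  have e3 := weylSum_linCoeff h.gen (scat q₀) (scat_inv h.gen.x0 h.x0 h.x0')
    (scat_inv h.gen.y0 h.y0 h.y0') h.scat_ne.1 h.swap.scat_ne.1 (scat_relation h.x0 h.y0)
  have e4 := weylSum_linCoeff h.gen (scat q₁) (scat_inv h.gen.x0 h.x1 h.x1')
    (scat_inv h.gen.y0 h.y1 h.y1') h.scat_ne.2.1 h.swap.scat_ne.2.1 (scat_relation h.x1 h.y1)
  have e4' := weylSum_linCoeffInv h.gen (scat q₁) (scat_inv h.gen.x0 h.x1 h.x1')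
    (scat_inv h.gen.y0 h.y1 h.y1')
  have e5 := weylSum_termPair_add_termRest h
  have e6 := signSum_pairCoeff h.gen
  have hsplit : ∀ f₀ f₁ f₂ f₃ f₄ f₅ f₆ : K → K → K,
      weylSum (fun u v => f₀ u v + f₁ u v + f₂ u v + f₃ u v + f₄ u v + f₅ u v + f₆ u v) x y
        = weylSum f₀ x y + weylSum f₁ x y + weylSum f₂ x y + weylSum f₃ x y + weylSum f₄ x y
          + weylSum (fun u v => f₅ u v + f₆ u v) x y := by
    intros; unfold weylSum; ring
  rw [hsplit (fun _ _ => triSum m (1 / (1 + q)) 1 1) (termM m q q₀ q₁) (termOdd m q q₀)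
    (fun u v => scat q₀ u * linCoeffFst q u v + scat q₀ v * linCoeffSnd q u v)
    (fun u v => (scat q₁ u)⁻¹ * linCoeffInvFst q u v + (scat q₁ v)⁻¹ * linCoeffInvSnd q u v)]
  rw [poisson_eq h.gen.x0 h.gen.x1 h.x0 h.x0', poisson_eq h.gen.x0 h.gen.x1 h.x1 h.x1',
    poisson_eq h.gen.y0 h.gen.y1 h.y0 h.y0', poisson_eq h.gen.y0 h.gen.y1 h.y1 h.y1']
  rw [mul_div_mul_comm] at e5
  linear_combination e0 + e1 + e2 + e3 + e4 + e4' + e5 + e6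

/-! ### Squares of Hall-Littlewood polynomials in two variables -/

/-- The factor of `C` for a short root, as a rational function of `x = exp (i ξ_j)`. -/
def shortFactor (q₀ x : K) : K := (1 - q₀ * x⁻¹) / (1 - (x⁻¹) ^ 2)

/-- The factor of `C` for a long root, as a rational function of `z = exp (i (ξ_j ± ξ_k))`. -/
def longFactor (q z : K) : K := (1 - q * z⁻¹) / (1 - z⁻¹)

/-- The function `C` in two variables, as a rational function of `x = exp (i ξ₁)` and `y = exp (i ξ₂)`. -/
def coeffC (q q₀ x y : K) : K :=
  shortFactor q₀ x * shortFactor q₀ y * (longFactor q (x / y) * longFactor q (x * y))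

/-- The Hall-Littlewood polynomial of `μ = (l, k)` as a rational function of `x = exp (i ξ₁)` and
`y = exp (i ξ₂)`. -/
def hallLittlewood (q q₀ : K) (l k : ℕ) (x y : K) : K :=
  weylSum (fun u v => coeffC q q₀ u v * (u ^ l * v ^ k)) x y

theorem shortFactor_eq {p x : K} (hx : x ≠ 0) (h : x ^ 2 - 1 ≠ 0) (h1 : 1 - p * x ≠ 0) :
    shortFactor p x = -(x * scat p x) * shortFactor p x⁻¹ := by
  have h' : 1 - x ^ 2 ≠ 0 := fun e => h (by linear_combination -e)
  unfold shortFactor scat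
  rw [inv_inv, show 1 - x⁻¹ ^ 2 = (x ^ 2 - 1) / x ^ 2 by field_simp]
  field_simp
  ring

theorem longFactor_eq {p x : K} (hx : x ≠ 0) (h : x - 1 ≠ 0) (h1 : 1 - p * x ≠ 0) :
    longFactor p x = -scat p x * longFactor p x⁻¹ := by
  have h' : 1 - x ≠ 0 := fun e => h (by linear_combination -e)
  unfold longFactor scat
  rw [inv_inv, show 1 - x⁻¹ = (x - 1) / x by field_simp]
  field_simp
  ring

/-- `C(x, y) * C(x⁻¹, y⁻¹)` is invariant under transposition. -/
theorem coeffC_mul_inv_swap (q q₀ x y : K) :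
    coeffC q q₀ y x * coeffC q q₀ y⁻¹ x⁻¹ = coeffC q q₀ x y * coeffC q q₀ x⁻¹ y⁻¹ := by
  unfold coeffC
  simp only [mul_comm y x, mul_comm y⁻¹ x⁻¹, inv_div_inv]
  ring

/-- `C(x, y) * C(x⁻¹, y⁻¹)` is invariant under inversion of `x`. -/
theorem coeffC_mul_inv_inv (q q₀ x y : K) :
    coeffC q q₀ x⁻¹ y * coeffC q q₀ x⁻¹⁻¹ y⁻¹ = coeffC q q₀ x y * coeffC q q₀ x⁻¹ y⁻¹ := by
  unfold coeffC
  simp only [inv_inv, div_inv_eq_mul, ← div_eq_mul_inv, inv_mul_eq_div]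
  ring

/-- Flipping the sign of a root multiplies its factor of `C` by a scattering factor, so the product of
one summand with the whole polynomial is a multiple of `C(x, y) * C(x⁻¹, y⁻¹)`. -/
theorem coeffC_mul_hallLittlewood {q q₀ x y : K} (h : Generic q x y) (hx : 1 - q₀ * x ≠ 0)
    (hy : 1 - q₀ * y ≠ 0) (l k : ℕ) :
    coeffC q q₀ x y * (x ^ l * y ^ k) * hallLittlewood q q₀ l k x y
      = coeffC q q₀ x y * coeffC q q₀ x⁻¹ y⁻¹ *
        crossTerm q q₀ (fun a b => a ^ l * b ^ k) x y := by
  have s1 := shortFactor_eq h.x0 h.x1 hx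
  have s2 := shortFactor_eq h.y0 h.y1 hy
  have l1 := longFactor_eq (mul_ne_zero h.x0 h.y0) h.xy h.qxy
  have l2 := longFactor_eq (p := q) (x := x / y) (div_ne_zero h.x0 h.y0)
    (by rw [div_sub_one h.y0]; exact div_ne_zero h.x_y h.y0)
    (ne_zero_of_mul_eq (b := y) (by have := h.y0; field_simp) h.yqx)
  have z1 : x⁻¹ * y = (x / y)⁻¹ := by rw [inv_div]; ring
  have z2 : x⁻¹ / y = (x * y)⁻¹ := by rw [mul_inv]; ring
  have z3 : y⁻¹ * x = x / y := by ring
  have z4 : y⁻¹ / x = (x * y)⁻¹ := by rw [mul_inv]; ring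
  have z5 : x⁻¹ * y⁻¹ = (x * y)⁻¹ := by rw [mul_inv]
  have z6 : x⁻¹ / y⁻¹ = (x / y)⁻¹ := by rw [inv_div, div_inv_eq_mul]; ring
  have z7 : y⁻¹ / x⁻¹ = x / y := by rw [div_inv_eq_mul]; ring
  have z8 : y / x = (x / y)⁻¹ := by rw [inv_div]
  have z9 : y * x⁻¹ = (x / y)⁻¹ := by rw [inv_div]; ring
  have z10 : x / y⁻¹ = x * y := by rw [div_inv_eq_mul]
  have z11 : y / x⁻¹ = x * y := by rw [div_inv_eq_mul, mul_comm]
  have hX : x ^ l ≠ 0 := pow_ne_zero _ h.x0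
  have hY : y ^ l ≠ 0 := pow_ne_zero _ h.y0
  have hX' : x ^ k ≠ 0 := pow_ne_zero _ h.x0
  have hY' : y ^ k ≠ 0 := pow_ne_zero _ h.y0
  rw [mul_assoc (coeffC q q₀ x y), mul_assoc (coeffC q q₀ x y)]
  congr 1
  unfold hallLittlewood crossTerm weylSum coeffC
  beta_reduce
  rw [mul_comm y x, mul_comm y⁻¹ x⁻¹]
  simp only [z1, z2, z3, z4, z5, z6, z7, z9, z10, z11, ← div_eq_mul_inv x y]
  rw [z8, s1, s2, l1, l2]
  generalize scat q₀ x = a1, scat q₀ y = a2, scat q (x * y) = s, scat q (x / y) = r,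
    shortFactor q₀ x⁻¹ = κ1, shortFactor q₀ y⁻¹ = κ2, longFactor q (x / y)⁻¹ = L1,
    longFactor q (x * y)⁻¹ = L2
  simp only [one_pow, div_pow, mul_pow, inv_pow, ← pow_mul, mul_comm 2, mul_one, one_mul]
  simp only [pow_mul]
  generalize x ^ l = A at *
  generalize y ^ l = B at *
  generalize x ^ k = A' at *
  generalize y ^ k = B' at *
  field_simp
  ring

theorem hallLittlewood_sq {m : ℕ} {q q₀ q₁ x y : K} (h : Bethe m q q₀ q₁ x y) (l k : ℕ) :
    hallLittlewood q q₀ l k x y ^ 2 = coeffC q q₀ x y * coeffC q q₀ x⁻¹ y⁻¹ *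
      weylSum (crossTerm q q₀ (fun a b => a ^ l * b ^ k)) x y := by
  have hP : ∀ u v, hallLittlewood q q₀ l k v u = hallLittlewood q q₀ l k u v :=
    fun u v => weylSum_swap _ _ _
  have hP' : ∀ u v, hallLittlewood q q₀ l k u⁻¹ v = hallLittlewood q q₀ l k u v :=
    fun u v => weylSum_inv _ _ _
  have key : ∀ u v, Bethe m q q₀ q₁ u v → coeffC q q₀ u v * coeffC q q₀ u⁻¹ v⁻¹ =
      coeffC q q₀ x y * coeffC q q₀ x⁻¹ y⁻¹ →
      coeffC q q₀ u v * (u ^ l * v ^ k) * hallLittlewood q q₀ l k u v =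
      coeffC q q₀ x y * coeffC q q₀ x⁻¹ y⁻¹ * crossTerm q q₀ (fun a b => a ^ l * b ^ k) u v := by
    intro u v h e
    rw [coeffC_mul_hallLittlewood h.gen h.x0 h.y0, e]
  have n1 := coeffC_mul_inv_swap q q₀
  have n2 := coeffC_mul_inv_inv q q₀
  have k1 := key x y h rfl
  have k2 := key y x h.swap (n1 _ _)
  have k3 := key x⁻¹ y h.inv (n2 _ _)
  have k4 := key y x⁻¹ h.inv.swap (by rw [n1, n2])
  have k5 := key y⁻¹ x h.swap.inv (by rw [n2, n1])
  have k6 := key x y⁻¹ h.swap.inv.swap (by rw [n1, n2, n1])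
  have k7 := key x⁻¹ y⁻¹ h.swap.inv.swap.inv (by rw [n2, n1, n2, n1])
  have k8 := key y⁻¹ x⁻¹ h.inv.swap.inv (by rw [n2, n1, n2])
  rw [hP x y] at k2
  rw [hP'] at k3
  rw [hP, hP'] at k4
  rw [hP', hP x y] at k5
  rw [hP, hP', hP x y] at k6
  rw [hP', hP, hP', hP x y] at k7
  rw [hP', hP, hP'] at k8
  rw [sq]
  conv_lhs => arg 1; rw [hallLittlewood]
  unfold weylSum
  linear_combination k1 + k2 + k3 + k4 + k5 + k6 + k7 + k8

theorem weylSum_crossTerm_sum {ι : Type*} (s : Finset ι) (q q₀ : K) (T : ι → K → K → K) (x y : K) :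
    weylSum (crossTerm q q₀ fun a b => ∑ i ∈ s, T i a b) x y
      = ∑ i ∈ s, weylSum (crossTerm q q₀ (T i)) x y := by
  simp only [weylSum, crossTerm, sum_add_distrib, sum_sub_distrib, mul_sum]

theorem weylSum_crossTerm_add (q q₀ : K) (T T' : K → K → K) (x y : K) :
    weylSum (crossTerm q q₀ fun a b => T a b + T' a b) x y
      = weylSum (crossTerm q q₀ T) x y + weylSum (crossTerm q q₀ T') x y := by
  simp only [weylSum, crossTerm]; ring

theorem weylSum_crossTerm_mul (q q₀ c : K) (T : K → K → K) (x y : K) :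
    weylSum (crossTerm q q₀ fun a b => c * T a b) x y
      = c * weylSum (crossTerm q q₀ T) x y := by
  simp only [weylSum, crossTerm]; ring

/-- The weighted sum of squares of Hall-Littlewood polynomials at a Bethe point. The diagonal weight
`1 / (1 + q)` is the value of `δ_μ` for `μ₁ = μ₂`. -/
theorem sum_hallLittlewood_sq {m : ℕ} {q q₀ q₁ x y : K} (h : Bethe m q q₀ q₁ x y) :
    ∑ l ∈ range (m + 1), (∑ k ∈ range l, hallLittlewood q q₀ l k x y ^ 2
      + 1 / (1 + q) * hallLittlewood q q₀ l l x y ^ 2)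
    = coeffC q q₀ x y * coeffC q q₀ x⁻¹ y⁻¹ *
      ((2 * (m + 1) + poisson q₀ x + poisson q₁ x + (poisson q (x * y) + poisson q (x / y)))
          * (2 * (m + 1) + poisson q₀ y + poisson q₁ y + (poisson q (x * y) + poisson q (x / y)))
        - (poisson q (x * y) - poisson q (x / y)) ^ 2) := by
  rw [← weylSum_diagTerm h, show diagTerm m q q₀ = crossTerm q q₀ fun a b =>
    ∑ l ∈ range (m + 1), (∑ k ∈ range l, a ^ l * b ^ k + 1 / (1 + q) * (a ^ l * b ^ l)) from rfl,
    weylSum_crossTerm_sum, mul_sum]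
  refine sum_congr rfl fun l _ => ?_
  rw [weylSum_crossTerm_add, weylSum_crossTerm_sum, weylSum_crossTerm_mul, hallLittlewood_sq h,
    sum_congr rfl fun k _ => hallLittlewood_sq h l k, ← mul_sum]
  ring

/-! ### One variable -/

/-- The sum of squares of the Hall-Littlewood polynomials in one variable at a solution of the Bethe
equation. -/
theorem sum_shortFactor_sq {m : ℕ} {q₀ q₁ x : K} (hx : x ≠ 0) (hx1 : x ^ 2 - 1 ≠ 0)
    (h0 : 1 - q₀ * x ≠ 0) (h0' : x - q₀ ≠ 0) (h1 : 1 - q₁ * x ≠ 0) (h1' : x - q₁ ≠ 0)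
    (he : (x ^ 2) ^ (m + 1) * (scat q₀ x * scat q₁ x) = 1) :
    ∑ l ∈ range (m + 1), (shortFactor q₀ x * x ^ l + shortFactor q₀ x⁻¹ * x⁻¹ ^ l) ^ 2
      = shortFactor q₀ x * shortFactor q₀ x⁻¹ *
        (2 * (m + 1) + poisson q₀ x + poisson q₁ x) := by
  have hne := right_ne_zero_of_mul (he ▸ one_ne_zero)
  obtain ⟨ha, hb⟩ := mul_ne_zero_iff.1 hne
  have hterm : ∀ l ∈ range (m + 1),
      (shortFactor q₀ x * x ^ l + shortFactor q₀ x⁻¹ * x⁻¹ ^ l) ^ 2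
        = shortFactor q₀ x * shortFactor q₀ x⁻¹ *
          (2 - x * scat q₀ x * (x ^ 2) ^ l - (x * scat q₀ x)⁻¹ * (x⁻¹ ^ 2) ^ l) := by
    intro l _
    rw [shortFactor_eq hx hx1 h0]
    have hX : x ^ l ≠ 0 := pow_ne_zero _ hx
    simp only [inv_pow, ← pow_mul, mul_comm 2]
    simp only [pow_mul]
    generalize x ^ l = X at *
    field_simp
    ring
  have hg : geom m (x⁻¹ ^ 2)
      = ((x ^ 2) ^ (m + 1))⁻¹ / (x⁻¹ ^ 2 - 1) - 1 / (x⁻¹ ^ 2 - 1) := by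
    rw [geom_eq, inv_pow, inv_pow, sub_div]
    intro e
    rw [inv_pow, inv_eq_one] at e
    exact hx1 (by rw [e, sub_self])
  have hB : (x ^ 2) ^ (m + 1) = (scat q₀ x * scat q₁ x)⁻¹ := eq_inv_of_mul_eq_one_left he
  rw [sum_congr rfl hterm, ← mul_sum, sum_sub_distrib, sum_sub_distrib, ← mul_sum, ← mul_sum]
  change _ * (_ - _ * geom m (x ^ 2) - _ * geom m (x⁻¹ ^ 2)) = _
  rw [hg, geom_eq m (sub_ne_zero.1 hx1), hB, poisson_eq hx hx1 h0 h0', poisson_eq hx hx1 h1 h1',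
    show x⁻¹ ^ 2 - 1 = -(x ^ 2 - 1) / x ^ 2 by field_simp; ring, sum_const, card_range,
    nsmul_eq_mul]
  congr 1
  generalize scat q₀ x = a at *
  generalize scat q₁ x = b at *
  generalize x ^ 2 - 1 = d at *
  push_cast
  field_simp
  ring

end Algebra

/-! ### The scattering phase -/

/-- The point `exp (i θ)` of the unit circle. -/
noncomputable def phase (θ : ℝ) : ℂ := Complex.exp (Complex.I * θ)

theorem phase_add (s t : ℝ) : phase (s + t) = phase s * phase t := by
  simp [phase, mul_add, Complex.exp_add]

theorem phase_neg (t : ℝ) : phase (-t) = (phase t)⁻¹ := by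
  simp [phase, Complex.exp_neg]

theorem phase_sub (s t : ℝ) : phase (s - t) = phase s / phase t := by
  rw [sub_eq_add_neg, phase_add, phase_neg, div_eq_mul_inv]

theorem phase_ne_zero (t : ℝ) : phase t ≠ 0 := Complex.exp_ne_zero _

theorem norm_phase (t : ℝ) : ‖phase t‖ = 1 := by
  rw [phase, mul_comm]; exact Complex.norm_exp_ofReal_mul_I t

theorem phase_natCast_mul (k : ℕ) (t : ℝ) : phase (k * t) = phase t ^ k := by
  rw [phase, phase, ← Complex.exp_nat_mul]; push_cast; ring_nf

theorem phase_eq_cos_add_sin (t : ℝ) : phase t = Real.cos t + Real.sin t * Complex.I := by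
  rw [phase, mul_comm, Complex.exp_mul_I]; simp

theorem phase_inv_eq_cos_sub_sin (t : ℝ) :
    (phase t)⁻¹ = Real.cos t - Real.sin t * Complex.I := by
  rw [← phase_neg, phase_eq_cos_add_sin]; simp; ring

theorem conj_phase (t : ℝ) : (starRingEnd ℂ) (phase t) = (phase t)⁻¹ := by
  rw [phase, ← Complex.exp_conj, ← Complex.exp_neg]; simp

theorem phase_two_pi_mul_int (k : ℤ) : phase (2 * Real.pi * k) = 1 := by
  rw [phase, Complex.exp_eq_one_iff]
  exact ⟨k, by push_cast; ring⟩

theorem phase_ne_one {t : ℝ} (h0 : 0 < t) (h1 : t < 2 * Real.pi) : phase t ≠ 1 := by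
  rw [phase, Ne, Complex.exp_eq_one_iff]
  rintro ⟨k, hk⟩
  have h2 : (t : ℂ) = ((k * (2 * Real.pi) : ℝ) : ℂ) := by
    apply mul_left_cancel₀ Complex.I_ne_zero
    rw [hk]; push_cast; ring
  have h3 : t = k * (2 * Real.pi) := by exact_mod_cast h2
  have hp := Real.pi_pos
  have h4 : (0 : ℝ) < k := by
    by_contra! h
    nlinarith
  have h5 : (k : ℝ) < 1 := by
    by_contra! h
    nlinarith
  have h6 : 0 < k := by exact_mod_cast h4
  have h7 : k < 1 := by exact_mod_cast h5
  omega

theorem one_sub_mul_phase_ne_zero {q : ℝ} (hq : q ∈ Set.Ioo (-1 : ℝ) 1) {z : ℂ} (hz : ‖z‖ = 1) :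
    1 - (q : ℂ) * z ≠ 0 := by
  intro h
  have h1 : (q : ℂ) * z = 1 := by linear_combination -h
  have h2 := congrArg norm h1
  rw [norm_mul, hz, mul_one, norm_one, Complex.norm_real, Real.norm_eq_abs] at h2
  have := abs_lt.2 hq
  linarith

theorem phase_sub_ne_zero {q : ℝ} (hq : q ∈ Set.Ioo (-1 : ℝ) 1) {z : ℂ} (hz : ‖z‖ = 1) :
    z - (q : ℂ) ≠ 0 := by
  intro h
  have h1 : z = q := by linear_combination h
  rw [h1, Complex.norm_real, Real.norm_eq_abs] at hz
  have := abs_lt.2 hq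
  linarith

theorem one_sub_mul_cos_pos {q : ℝ} (hq : q ∈ Set.Ioo (-1 : ℝ) 1) (t : ℝ) :
    0 < 1 - q * Real.cos t := by
  have h1 := abs_lt.2 hq
  have h2 := Real.abs_cos_le_one t
  have h3 : |q * Real.cos t| < 1 := by
    rw [abs_mul]; nlinarith [abs_nonneg q, abs_nonneg (Real.cos t)]
  linarith [(abs_lt.1 h3).2]

/-- A closed form for `v_q` on the whole real line. -/
theorem v_eq {q : ℝ} (hq : q ∈ Set.Ioo (-1 : ℝ) 1) (θ : ℝ) :
    v q θ = θ + 2 * Real.arctan (q * Real.sin θ / (1 - q * Real.cos θ)) := by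
  -- the right-hand side is an antiderivative of `u q` that vanishes at `0`
  have hd : ∀ t : ℝ, HasDerivAt
      (fun t => t + 2 * Real.arctan (q * Real.sin t / (1 - q * Real.cos t))) (u q t) t := by
    intro t
    have hc := one_sub_mul_cos_pos hq t
    have hu := u_denom_pos hq t
    have h1 := ((Real.hasDerivAt_sin t).const_mul q).div
      (((Real.hasDerivAt_cos t).const_mul q).const_sub 1) hc.ne'
    refine ((hasDerivAt_id t).add (h1.arctan.const_mul 2)).congr_deriv ?_
    have hsc := Real.sin_sq_add_cos_sq t
    have hne : (1 - q * Real.cos t) ^ 2 + (q * Real.sin t) ^ 2 = 1 - 2 * q * Real.cos t + q ^ 2 := by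
      linear_combination q ^ 2 * hsc
    have hs2 : Real.sin t ^ 2 = 1 - Real.cos t ^ 2 := by linarith
    rw [Pi.div_apply, u, div_pow, one_add_div (pow_pos hc 2).ne', hne]
    field_simp
    ring_nf
    rw [hs2]
    ring
  have h := intervalIntegral.integral_eq_sub_of_hasDerivAt (a := 0) (b := θ) (fun t _ => hd t)
    ((continuous_u hq).intervalIntegrable _ _)
  rw [v, h]
  simp

theorem phase_v {q : ℝ} (hq : q ∈ Set.Ioo (-1 : ℝ) 1) (θ : ℝ) :
    phase (v q θ) = scat (q : ℂ) (phase θ) := by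
  have hc := one_sub_mul_cos_pos hq θ
  have hx := one_sub_mul_phase_ne_zero hq (norm_phase θ)
  rw [v_eq hq, phase_add, two_mul, phase_add]
  set w := q * Real.sin θ / (1 - q * Real.cos θ) with hw
  have hpos : 0 < 1 + w ^ 2 := by positivity
  have h1 : phase (Real.arctan w) = (1 + w * Complex.I) / (Real.sqrt (1 + w ^ 2) : ℝ) := by
    rw [phase_eq_cos_add_sin, Real.cos_arctan, Real.sin_arctan]
    push_cast; ring
  have h2 : ((Real.sqrt (1 + w ^ 2) : ℝ) : ℂ) * (Real.sqrt (1 + w ^ 2) : ℝ) = 1 + (w : ℂ) ^ 2 := by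
    rw [← Complex.ofReal_mul, Real.mul_self_sqrt hpos.le]; push_cast; ring
  have h3 : (1 + (w : ℂ) ^ 2) = (1 + w * Complex.I) * (1 - w * Complex.I) := by
    linear_combination ((w : ℂ) ^ 2) * Complex.I_sq
  have h4 : (1 + (w : ℂ) ^ 2) ≠ 0 := by exact_mod_cast hpos.ne'
  have h5 : (1 + (w : ℂ) * Complex.I) ≠ 0 := by rw [h3] at h4; exact left_ne_zero_of_mul h4
  have h6 : (1 - (w : ℂ) * Complex.I) ≠ 0 := by rw [h3] at h4; exact right_ne_zero_of_mul h4
  rw [h1, div_mul_div_comm, h2, h3, mul_div_mul_left _ _ h5, scat, ← mul_div_assoc,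
    div_eq_div_iff h6 hx]
  have hd : (1 - (q : ℂ) * Real.cos θ) ≠ 0 := by exact_mod_cast hc.ne'
  have hwc : (w : ℂ) = q * Real.sin θ / (1 - q * Real.cos θ) := by rw [hw]; push_cast; ring
  -- up to a common factor, `1 ± w I` are `1 - q x⁻¹` and `1 - q x` for `x = phase θ`
  have h7 : 1 + (w : ℂ) * Complex.I = (1 - q * (phase θ)⁻¹) / (1 - (q : ℂ) * Real.cos θ) := by
    rw [hwc, phase_inv_eq_cos_sub_sin, eq_div_iff hd, add_mul, mul_right_comm _ Complex.I,
      div_mul_cancel₀ _ hd]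
    ring
  have h8 : 1 - (w : ℂ) * Complex.I = (1 - q * phase θ) / (1 - (q : ℂ) * Real.cos θ) := by
    rw [hwc, phase_eq_cos_add_sin, eq_div_iff hd, sub_mul, mul_right_comm _ Complex.I,
      div_mul_cancel₀ _ hd]
    ring
  have h0 := phase_ne_zero θ
  rw [h7, h8]
  generalize (1 - (q : ℂ) * Real.cos θ) = d at *
  field_simp

theorem u_eq_poisson {q : ℝ} (hq : q ∈ Set.Ioo (-1 : ℝ) 1) (θ : ℝ) :
    ((u q θ : ℝ) : ℂ) = poisson (q : ℂ) (phase θ) := by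
  have h1 := one_sub_mul_phase_ne_zero hq (norm_phase θ)
  have h2 := phase_sub_ne_zero hq (norm_phase θ)
  have h0 := phase_ne_zero θ
  have h3 : ((1 - 2 * q * Real.cos θ + q ^ 2 : ℝ) : ℂ) ≠ 0 := by
    exact_mod_cast (u_denom_pos hq θ).ne'
  have h4 : (2 * (Real.cos θ : ℂ)) = phase θ + (phase θ)⁻¹ := by
    rw [phase_inv_eq_cos_sub_sin, phase_eq_cos_add_sin]; ring
  have h5 : ((1 - 2 * q * Real.cos θ + q ^ 2 : ℝ) : ℂ)
      = (1 - q * phase θ) * (phase θ - q) / phase θ := by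
    push_cast
    rw [mul_comm (2 : ℂ) q, mul_assoc, show (2 * Complex.cos θ) = phase θ + (phase θ)⁻¹ by
      rw [← h4]; simp]
    field_simp
    ring
  rw [u, Complex.ofReal_div, h5, poisson, div_div_eq_mul_div]
  push_cast
  ring

theorem v_neg {q : ℝ} (hq : q ∈ Set.Ioo (-1 : ℝ) 1) (θ : ℝ) : v q (-θ) = -v q θ := by
  rw [v_eq hq, v_eq hq, Real.sin_neg, Real.cos_neg, mul_neg, neg_div, Real.arctan_neg]; ring

theorem v_pi {q : ℝ} (hq : q ∈ Set.Ioo (-1 : ℝ) 1) : v q Real.pi = Real.pi := by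
  rw [v_eq hq]; simp

theorem v_add_two_pi {q : ℝ} (hq : q ∈ Set.Ioo (-1 : ℝ) 1) (θ : ℝ) :
    v q (θ + 2 * Real.pi) = v q θ + 2 * Real.pi := by
  rw [v_eq hq, v_eq hq, Real.sin_add_two_pi, Real.cos_add_two_pi]; ring

theorem v_nonpos {q θ : ℝ} (hq : q ∈ Set.Ioo (-1 : ℝ) 1) (h : θ ≤ 0) : v q θ ≤ 0 := by
  rw [← v_zero q]; exact monotone_v hq h

theorem pi_le_v {q θ : ℝ} (hq : q ∈ Set.Ioo (-1 : ℝ) 1) (h : Real.pi ≤ θ) : Real.pi ≤ v q θ := by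
  conv_lhs => rw [← v_pi hq]
  exact monotone_v hq h

/-! ### The node as a solution of the Bethe equations -/

/-- The node is a critical point of the Morse function. -/
theorem lineDeriv_node {n : ℕ} (m : ℕ) {q q₀ q₁ : ℝ} (hq : q ∈ Set.Ioo (-1 : ℝ) 1)
    (hq₀ : q₀ ∈ Set.Ioo (-1 : ℝ) 1) (hq₁ : q₁ ∈ Set.Ioo (-1 : ℝ) 1) (lam : Fin n → ℤ)
    (x : Fin n → ℝ) :
    lineDeriv ℝ (morse m q q₀ q₁ lam) (node m q q₀ q₁ lam) x = 0 :=
  ((isMinOn_morse_iff m hq hq₀ hq₁ lam _).2 rfl).lineDeriv_eq_zero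
    (Filter.Eventually.of_forall fun _ => Set.mem_univ _)

theorem mem_alcove {m n : ℕ} {μ : Fin n → ℤ} :
    μ ∈ alcove m n ↔ (∀ j, 0 ≤ μ j ∧ μ j ≤ m) ∧ Antitone μ := by
  classical
  simp [alcove, Fintype.mem_piFinset]

theorem Ioi_zero_fin_two : Finset.Ioi (0 : Fin 2) = {1} := rfl

theorem Ioi_one_fin_two : Finset.Ioi (1 : Fin 2) = ∅ := rfl

/-- The critical equation in one variable. -/
theorem node_one_eq (m : ℕ) {q q₀ q₁ : ℝ} (hq : q ∈ Set.Ioo (-1 : ℝ) 1)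
    (hq₀ : q₀ ∈ Set.Ioo (-1 : ℝ) 1) (hq₁ : q₁ ∈ Set.Ioo (-1 : ℝ) 1) (lam : Fin 1 → ℤ)
    {a : ℝ} (ha : node m q q₀ q₁ lam 0 = a) :
    2 * ((m : ℝ) + 1) * a + v q₀ a + v q₁ a = 2 * Real.pi * (1 + lam 0) := by
  have h0 := lineDeriv_node m hq hq₀ hq₁ lam (Pi.single 0 1)
  rw [lineDeriv_morse m hq hq₀ hq₁] at h0
  simp [ha, rho] at h0
  linarith

/-- The critical equations in two variables. -/
theorem node_two_eq (m : ℕ) {q q₀ q₁ : ℝ} (hq : q ∈ Set.Ioo (-1 : ℝ) 1)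
    (hq₀ : q₀ ∈ Set.Ioo (-1 : ℝ) 1) (hq₁ : q₁ ∈ Set.Ioo (-1 : ℝ) 1) (lam : Fin 2 → ℤ)
    {a b : ℝ} (ha : node m q q₀ q₁ lam 0 = a) (hb : node m q q₀ q₁ lam 1 = b) :
    2 * ((m : ℝ) + 1) * a + v q₀ a + v q₁ a + v q (a + b) + v q (a - b)
        = 2 * Real.pi * (2 + lam 0) ∧
    2 * ((m : ℝ) + 1) * b + v q₀ b + v q₁ b + v q (a + b) - v q (a - b)
        = 2 * Real.pi * (1 + lam 1) := by
  have h0 := lineDeriv_node m hq hq₀ hq₁ lam (Pi.single 0 1)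
  have h1 := lineDeriv_node m hq hq₀ hq₁ lam (Pi.single 1 1)
  rw [lineDeriv_morse m hq hq₀ hq₁] at h0 h1
  simp [Fin.sum_univ_two, Ioi_one_fin_two, ha, hb, rho] at h0 h1
  constructor <;> linarith

/-- The node lies in the open alcove `0 < ξ₁ < π`. -/
theorem node_one_bounds (m : ℕ) {q q₀ q₁ : ℝ} (hq : q ∈ Set.Ioo (-1 : ℝ) 1)
    (hq₀ : q₀ ∈ Set.Ioo (-1 : ℝ) 1) (hq₁ : q₁ ∈ Set.Ioo (-1 : ℝ) 1) {lam : Fin 1 → ℤ}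
    (hlam : lam ∈ alcove m 1) {a : ℝ} (ha : node m q q₀ q₁ lam 0 = a) : 0 < a ∧ a < Real.pi := by
  have h := node_one_eq m hq hq₀ hq₁ lam ha
  obtain ⟨hl, -⟩ := mem_alcove.1 hlam
  have h1 : (0 : ℝ) ≤ lam 0 := by exact_mod_cast (hl 0).1
  have h2 : (lam 0 : ℝ) ≤ m := by exact_mod_cast (hl 0).2
  have hp := Real.pi_pos
  have hm : (0 : ℝ) ≤ m := Nat.cast_nonneg m
  constructor
  · by_contra! hc
    have := v_nonpos hq₀ hc
    have := v_nonpos hq₁ hc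
    have : 2 * ((m : ℝ) + 1) * a ≤ 0 := mul_nonpos_of_nonneg_of_nonpos (by positivity) hc
    have : 0 < 2 * Real.pi * (1 + lam 0) := by positivity
    linarith
  · by_contra! hc
    have := pi_le_v hq₀ hc
    have := pi_le_v hq₁ hc
    nlinarith

/-- The node lies in the open alcove `0 < ξ₂ < ξ₁ < π`. -/
theorem node_two_bounds (m : ℕ) {q q₀ q₁ : ℝ} (hq : q ∈ Set.Ioo (-1 : ℝ) 1)
    (hq₀ : q₀ ∈ Set.Ioo (-1 : ℝ) 1) (hq₁ : q₁ ∈ Set.Ioo (-1 : ℝ) 1) {lam : Fin 2 → ℤ}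
    (hlam : lam ∈ alcove m 2) {a b : ℝ} (ha : node m q q₀ q₁ lam 0 = a)
    (hb : node m q q₀ q₁ lam 1 = b) : 0 < b ∧ b < a ∧ a < Real.pi := by
  obtain ⟨h, h'⟩ := node_two_eq m hq hq₀ hq₁ lam ha hb
  obtain ⟨hl, hanti⟩ := mem_alcove.1 hlam
  have h1 : (0 : ℝ) ≤ lam 1 := by exact_mod_cast (hl 1).1
  have h2 : (lam 0 : ℝ) ≤ m := by exact_mod_cast (hl 0).2
  have h3 : (lam 1 : ℝ) ≤ lam 0 := by exact_mod_cast hanti (Fin.zero_le 1)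
  have hp := Real.pi_pos
  have hm : (0 : ℝ) ≤ m := Nat.cast_nonneg m
  have hba : b < a := by
    by_contra! hc
    have := monotone_v hq₀ hc
    have := monotone_v hq₁ hc
    have := v_nonpos hq (sub_nonpos.2 hc)
    nlinarith
  refine ⟨?_, hba, ?_⟩
  · by_contra! hc
    have := v_nonpos hq₀ hc
    have := v_nonpos hq₁ hc
    have := monotone_v hq (by linarith : a + b ≤ a - b)
    have : 2 * ((m : ℝ) + 1) * b ≤ 0 := mul_nonpos_of_nonneg_of_nonpos (by positivity) hc
    have : 0 < 2 * Real.pi * (1 + lam 1) := by positivity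
    linarith
  · by_contra! hc
    have := pi_le_v hq₀ hc
    have := pi_le_v hq₁ hc
    -- for `a ≥ π` this gives `v q (a + b) + v q (a - b) ≥ 2π`
    have e1 := monotone_v hq (by linarith : -(a - b) + 2 * Real.pi ≤ a + b)
    rw [v_add_two_pi hq, v_neg hq] at e1
    nlinarith

/-- The exponentiated critical equations are the Bethe equations. -/
theorem bethe_of_node (m : ℕ) {q q₀ q₁ : ℝ} (hq : q ∈ Set.Ioo (-1 : ℝ) 1)
    (hq₀ : q₀ ∈ Set.Ioo (-1 : ℝ) 1) (hq₁ : q₁ ∈ Set.Ioo (-1 : ℝ) 1) {lam : Fin 2 → ℤ}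
    (hlam : lam ∈ alcove m 2) {a b : ℝ} (ha : node m q q₀ q₁ lam 0 = a)
    (hb : node m q q₀ q₁ lam 1 = b) :
    Bethe m (q : ℂ) (q₀ : ℂ) (q₁ : ℂ) (phase a) (phase b) := by
  obtain ⟨h, h'⟩ := node_two_eq m hq hq₀ hq₁ lam ha hb
  obtain ⟨hb0, hba, hap⟩ := node_two_bounds m hq hq₀ hq₁ hlam ha hb
  have hx := norm_phase a
  have hy := norm_phase b
  have hxy : ‖phase a * phase b‖ = 1 := by rw [norm_mul, hx, hy, one_mul]
  have hxdy : ‖phase a / phase b‖ = 1 := by rw [norm_div, hx, hy, one_div_one]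
  have hydx : ‖phase b / phase a‖ = 1 := by rw [norm_div, hx, hy, one_div_one]
  refine ⟨⟨phase_ne_zero a, phase_ne_zero b, ?_, ?_, ?_, ?_, ?_,
    one_sub_mul_phase_ne_zero hq hxy, phase_sub_ne_zero hq hxy, ?_, ?_⟩,
    one_sub_mul_phase_ne_zero hq₀ hx, phase_sub_ne_zero hq₀ hx,
    one_sub_mul_phase_ne_zero hq₀ hy, phase_sub_ne_zero hq₀ hy,
    one_sub_mul_phase_ne_zero hq₁ hx, phase_sub_ne_zero hq₁ hx,
    one_sub_mul_phase_ne_zero hq₁ hy, phase_sub_ne_zero hq₁ hy, ?_, ?_⟩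
  · have := hq.1
    exact_mod_cast (by linarith : (1 : ℝ) + q ≠ 0)
  · rw [sq, ← phase_add, sub_ne_zero]
    exact phase_ne_one (by linarith) (by linarith)
  · rw [sq, ← phase_add, sub_ne_zero]
    exact phase_ne_one (by linarith) (by linarith)
  · rw [← phase_add, sub_ne_zero]
    exact phase_ne_one (by linarith) (by linarith)
  · have := phase_ne_one (t := a - b) (by linarith) (by linarith)
    rw [phase_sub, Ne, div_eq_one_iff_eq (phase_ne_zero b)] at this
    exact sub_ne_zero.2 this
  · have := phase_sub_ne_zero hq hxdy
    rw [div_sub' (phase_ne_zero b), mul_comm] at this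
    exact (div_ne_zero_iff.1 this).1
  · have := phase_sub_ne_zero hq hydx
    rw [div_sub' (phase_ne_zero a), mul_comm] at this
    exact (div_ne_zero_iff.1 this).1
  · rw [← phase_v hq₀, ← phase_v hq₁, ← phase_add a b, ← phase_sub, ← phase_v hq, ← phase_v hq,
      ← pow_mul, ← phase_natCast_mul, ← phase_add, ← phase_add, ← phase_add, ← phase_add,
      ← phase_two_pi_mul_int (2 + lam 0)]
    congr 1
    push_cast
    linarith
  · rw [← phase_v hq₀, ← phase_v hq₁, ← phase_add b a, ← phase_sub, ← phase_v hq, ← phase_v hq,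
      ← pow_mul, ← phase_natCast_mul, ← phase_add, ← phase_add, ← phase_add, ← phase_add,
      ← phase_two_pi_mul_int (1 + lam 1), ← neg_sub a b, v_neg hq, add_comm b a]
    congr 1
    push_cast
    linarith

/-! ### Explicit forms for one and two variables -/

theorem C_one (q q₀ : ℝ) (ξ : Fin 1 → ℝ) :
    C q q₀ ξ = shortFactor (q₀ : ℂ) (phase (ξ 0)) := by
  have e1 : ∀ t : ℝ, Complex.exp (-Complex.I * t) = (phase t)⁻¹ := fun t => by
    rw [phase, ← Complex.exp_neg, neg_mul]
  have e2 : ∀ t : ℝ, Complex.exp (-2 * Complex.I * t) = (phase t)⁻¹ ^ 2 := fun t => by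
    rw [phase, ← Complex.exp_neg, ← Complex.exp_nat_mul]; push_cast; ring_nf
  simp only [C, e1, e2, shortFactor]
  simp

theorem C_two (q q₀ : ℝ) (ξ : Fin 2 → ℝ) :
    C q q₀ ξ = coeffC (q : ℂ) (q₀ : ℂ) (phase (ξ 0)) (phase (ξ 1)) := by
  have e1 : ∀ t : ℝ, Complex.exp (-Complex.I * t) = (phase t)⁻¹ := fun t => by
    rw [phase, ← Complex.exp_neg, neg_mul]
  have e2 : ∀ t : ℝ, Complex.exp (-2 * Complex.I * t) = (phase t)⁻¹ ^ 2 := fun t => by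
    rw [phase, ← Complex.exp_neg, ← Complex.exp_nat_mul]; push_cast; ring_nf
  have e3 := e1 (ξ 0 - ξ 1)
  have e4 := e1 (ξ 0 + ξ 1)
  push_cast at e3 e4
  rw [C, coeffC]
  simp only [Fin.prod_univ_two, Ioi_zero_fin_two, Ioi_one_fin_two, prod_singleton, prod_empty,
    mul_one, e1, e2, e3, e4, shortFactor, longFactor, phase_sub, phase_add]

theorem exp_signedPerm_sum {n : ℕ} (ξ : Fin n → ℝ) (μ : Fin n → ℤ) (k : Fin n → ℕ)
    (hμ : ∀ j, μ j = k j) :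
    Complex.exp (Complex.I * ∑ j, ((ξ j : ℝ) : ℂ) * (μ j : ℂ)) = ∏ j, phase (ξ j) ^ k j := by
  rw [mul_sum, Complex.exp_sum]
  refine prod_congr rfl fun j _ => ?_
  rw [phase, ← Complex.exp_nat_mul, hμ]
  push_cast
  ring_nf

theorem sum_signs_two {M : Type*} [AddCommMonoid M] (f : (Fin 2 → ℤˣ) → M) :
    ∑ ε, f ε = f ![1, 1] + f ![-1, 1] + f ![1, -1] + f ![-1, -1] := by
  have : (Finset.univ : Finset (Fin 2 → ℤˣ)) = {![1, 1], ![-1, 1], ![1, -1], ![-1, -1]} := by decide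
  rw [this, sum_insert (by decide), sum_insert (by decide), sum_insert (by decide), sum_singleton]
  simp only [add_assoc]

theorem P_one (q q₀ : ℝ) (l : ℕ) (ξ : Fin 1 → ℝ) (μ : Fin 1 → ℤ) (h0 : μ 0 = l) :
    P q q₀ μ ξ = shortFactor (q₀ : ℂ) (phase (ξ 0)) * phase (ξ 0) ^ l
      + shortFactor (q₀ : ℂ) (phase (ξ 0))⁻¹ * (phase (ξ 0))⁻¹ ^ l := by
  have hexp : ∀ η : Fin 1 → ℝ, Complex.exp (Complex.I * ∑ j, ((η j : ℝ) : ℂ) * (μ j : ℂ))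
      = phase (η 0) ^ l := fun η => by
    rw [exp_signedPerm_sum η μ ![l] (by intro j; fin_cases j; simp [h0])]
    simp
  have hs : (Finset.univ : Finset (Fin 1 → ℤˣ)) = {![1], ![-1]} := by decide
  rw [P, Fintype.sum_unique, hs, sum_insert (by decide), sum_singleton]
  simp only [hexp, C_one, signedPerm]
  simp [phase_neg]

theorem P_two (q q₀ : ℝ) (l k : ℕ) (ξ : Fin 2 → ℝ) (μ : Fin 2 → ℤ) (h0 : μ 0 = l)
    (h1 : μ 1 = k) :
    P q q₀ μ ξ = hallLittlewood (q : ℂ) (q₀ : ℂ) l k (phase (ξ 0)) (phase (ξ 1)) := by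
  have hexp : ∀ η : Fin 2 → ℝ, Complex.exp (Complex.I * ∑ j, ((η j : ℝ) : ℂ) * (μ j : ℂ))
      = phase (η 0) ^ l * phase (η 1) ^ k := fun η => by
    rw [exp_signedPerm_sum η μ ![l, k] (by intro j; fin_cases j <;> simp [h0, h1])]
    simp [Fin.prod_univ_two]
  have hperm : (Finset.univ : Finset (Equiv.Perm (Fin 2))) = {1, Equiv.swap 0 1} := by decide
  rw [P, hperm, sum_insert (by decide), sum_singleton]
  simp only [hexp, sum_signs_two, C_two, signedPerm, hallLittlewood, weylSum]
  simp [phase_neg]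
  ring

theorem delta_one (q : ℝ) (μ : Fin 1 → ℤ) : delta q μ = 1 := by
  simp [delta]

theorem delta_two (q : ℝ) (μ : Fin 2 → ℤ) :
    delta q μ = if μ 0 = μ 1 then (1 - q) / (1 - q ^ 2) else 1 := by
  rw [delta, Fin.prod_univ_two, Ioi_zero_fin_two, Ioi_one_fin_two, filter_empty, prod_empty,
    mul_one, filter_singleton]
  split_ifs <;> simp

theorem sum_alcove_one {M : Type*} [AddCommMonoid M] (m : ℕ) (f : (Fin 1 → ℤ) → M) :
    ∑ μ ∈ alcove m 1, f μ = ∑ l ∈ range (m + 1), f ![(l : ℤ)] := by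
  symm
  refine sum_bij (fun l _ => ![(l : ℤ)]) ?_ ?_ ?_ fun _ _ => rfl
  · intro l hl
    rw [mem_range] at hl
    refine mem_alcove.2 ⟨fun j => ?_, fun i j _ => ?_⟩
    · simp; omega
    · simp [Subsingleton.elim i j]
  · intro l _ l' _ h
    simpa using congrFun h 0
  · intro μ hμ
    obtain ⟨h, -⟩ := mem_alcove.1 hμ
    refine ⟨(μ 0).toNat, mem_range.2 (by have := h 0; omega), ?_⟩
    funext j
    fin_cases j
    simpa using (h 0).1

theorem sum_alcove_two {M : Type*} [AddCommMonoid M] (m : ℕ) (f : (Fin 2 → ℤ) → M) :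
    ∑ μ ∈ alcove m 2, f μ
      = ∑ l ∈ range (m + 1), (∑ k ∈ range l, f ![(l : ℤ), k] + f ![(l : ℤ), l]) := by
  have h : ∀ l, ∑ k ∈ range l, f ![(l : ℤ), k] + f ![(l : ℤ), l]
      = ∑ k ∈ range (l + 1), f ![(l : ℤ), k] := fun l =>
    (sum_range_succ (fun k : ℕ => f ![(l : ℤ), k]) l).symm
  simp only [h]
  rw [sum_sigma']
  symm
  refine sum_bij (fun p _ => ![(p.1 : ℤ), p.2]) ?_ ?_ ?_ fun _ _ => rfl
  · rintro ⟨l, k⟩ hl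
    simp only [mem_sigma, mem_range] at hl
    refine mem_alcove.2 ⟨fun j => ?_, fun i j hij => ?_⟩
    · fin_cases j <;> simp <;> omega
    · fin_cases i <;> fin_cases j <;> simp_all
  · rintro ⟨l, k⟩ _ ⟨l', k'⟩ _ h
    have h0 := congrFun h 0
    have h1 := congrFun h 1
    simp at h0 h1
    subst h0 h1
    rfl
  · intro μ hμ
    obtain ⟨h, ha⟩ := mem_alcove.1 hμ
    have h01 : μ 1 ≤ μ 0 := ha (Fin.zero_le 1)
    have h0 := h 0
    have h1 := h 1
    refine ⟨⟨(μ 0).toNat, (μ 1).toNat⟩, ?_, ?_⟩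
    · simp only [mem_sigma, mem_range]; omega
    · funext j
      fin_cases j
      · simpa using h0.1
      · simpa using h1.1

theorem conj_shortFactor (q₀ : ℝ) {x : ℂ} (hx : (starRingEnd ℂ) x = x⁻¹) :
    (starRingEnd ℂ) (shortFactor (q₀ : ℂ) x) = shortFactor (q₀ : ℂ) x⁻¹ := by
  simp [shortFactor, hx]

theorem conj_coeffC (q q₀ : ℝ) {x y : ℂ} (hx : (starRingEnd ℂ) x = x⁻¹)
    (hy : (starRingEnd ℂ) y = y⁻¹) :
    (starRingEnd ℂ) (coeffC (q : ℂ) (q₀ : ℂ) x y) = coeffC (q : ℂ) (q₀ : ℂ) x⁻¹ y⁻¹ := by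
  simp [coeffC, shortFactor, longFactor, hx, hy]

/-- The Hall-Littlewood polynomials are real-valued on the torus. -/
theorem conj_hallLittlewood (q q₀ : ℝ) (l k : ℕ) {x y : ℂ} (hx : (starRingEnd ℂ) x = x⁻¹)
    (hy : (starRingEnd ℂ) y = y⁻¹) :
    (starRingEnd ℂ) (hallLittlewood (q : ℂ) (q₀ : ℂ) l k x y)
      = hallLittlewood (q : ℂ) (q₀ : ℂ) l k x y := by
  have hx' : (starRingEnd ℂ) x⁻¹ = x⁻¹⁻¹ := by rw [map_inv₀, hx]
  have hy' : (starRingEnd ℂ) y⁻¹ = y⁻¹⁻¹ := by rw [map_inv₀, hy]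
  simp only [hallLittlewood, weylSum, map_add, map_mul, map_pow, conj_coeffC q q₀ hx hy,
    conj_coeffC q q₀ hy hx, conj_coeffC q q₀ hx' hy, conj_coeffC q q₀ hy hx',
    conj_coeffC q q₀ hx hy', conj_coeffC q q₀ hy' hx, conj_coeffC q q₀ hx' hy',
    conj_coeffC q q₀ hy' hx', hx, hy, hx', hy', inv_inv]
  ring

theorem det_hessian_one (m : ℕ) {q q₀ q₁ : ℝ} (hq : q ∈ Set.Ioo (-1 : ℝ) 1)
    (hq₀ : q₀ ∈ Set.Ioo (-1 : ℝ) 1) (hq₁ : q₁ ∈ Set.Ioo (-1 : ℝ) 1) (lam : Fin 1 → ℤ)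
    (ξ : Fin 1 → ℝ) :
    (hessian m q q₀ q₁ lam ξ).det = 2 * ((m : ℝ) + 1) + u q₀ (ξ 0) + u q₁ (ξ 0) := by
  rw [Matrix.det_fin_one, hessian_apply m hq hq₀ hq₁]
  simp

theorem det_hessian_two (m : ℕ) {q q₀ q₁ : ℝ} (hq : q ∈ Set.Ioo (-1 : ℝ) 1)
    (hq₀ : q₀ ∈ Set.Ioo (-1 : ℝ) 1) (hq₁ : q₁ ∈ Set.Ioo (-1 : ℝ) 1) (lam : Fin 2 → ℤ)
    (ξ : Fin 2 → ℝ) :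
    (hessian m q q₀ q₁ lam ξ).det
      = (2 * ((m : ℝ) + 1) + u q₀ (ξ 0) + u q₁ (ξ 0) + (u q (ξ 0 + ξ 1) + u q (ξ 0 - ξ 1)))
        * (2 * ((m : ℝ) + 1) + u q₀ (ξ 1) + u q₁ (ξ 1) + (u q (ξ 0 + ξ 1) + u q (ξ 0 - ξ 1)))
        - (u q (ξ 0 + ξ 1) - u q (ξ 0 - ξ 1)) ^ 2 := by
  have e0 : (univ : Finset (Fin 2)).erase 0 = {1} := by decide
  have e1 : (univ : Finset (Fin 2)).erase 1 = {0} := by decide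
  have hu : u q (ξ 1 - ξ 0) = u q (ξ 0 - ξ 1) := by rw [← u_neg, neg_sub]
  rw [Matrix.det_fin_two]
  simp only [hessian_apply m hq hq₀ hq₁, e0, e1, sum_singleton, if_true, hu, add_comm (ξ 1) (ξ 0)]
  rw [if_neg (by decide), if_neg (by decide)]
  ring

/-! ### Christoffel weights -/

/-- If the sum of the `|P_μ|² δ_μ` is `|C|² D`, then the Christoffel weight is `D⁻¹`; the factor `|C|²`
can be cancelled because `C` does not vanish at the node. -/
theorem christoffel_eq {n m : ℕ} {q q₀ q₁ D : ℝ} {lam : Fin n → ℤ}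
    (hC : C q q₀ (node m q q₀ q₁ lam) ≠ 0)
    (h : ((∑ μ ∈ alcove m n, ‖P q q₀ μ (node m q q₀ q₁ lam)‖ ^ 2 * delta q μ : ℝ) : ℂ)
      = C q q₀ (node m q q₀ q₁ lam) * (starRingEnd ℂ) (C q q₀ (node m q q₀ q₁ lam)) * D) :
    christoffel m q q₀ q₁ lam = D⁻¹ := by
  have h' : ∑ μ ∈ alcove m n, ‖P q q₀ μ (node m q q₀ q₁ lam)‖ ^ 2 * delta q μ
      = ‖C q q₀ (node m q q₀ q₁ lam)‖ ^ 2 * D := by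
    rw [Complex.mul_conj'] at h
    exact_mod_cast h
  rw [christoffel, christoffelHat, h', mul_inv,
    mul_inv_cancel_left₀ (pow_ne_zero 2 (norm_ne_zero_iff.2 hC))]

theorem shortFactor_ne_zero {p x : ℂ} (hx : x ≠ 0) (hx1 : x ^ 2 - 1 ≠ 0) (h : x - p ≠ 0) :
    shortFactor p x ≠ 0 := by
  refine div_ne_zero (one_sub_inv_ne_zero hx h) (ne_zero_of_mul_eq (b := x ^ 2) (c := x ^ 2 - 1) ?_ hx1)
  field_simp

theorem longFactor_ne_zero {p x : ℂ} (hx : x ≠ 0) (hx1 : x - 1 ≠ 0) (h : x - p ≠ 0) :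
    longFactor p x ≠ 0 := by
  refine div_ne_zero (one_sub_inv_ne_zero hx h) (ne_zero_of_mul_eq (b := x) (c := x - 1) ?_ hx1)
  field_simp

theorem christoffel_one (m : ℕ) {q q₀ q₁ : ℝ} (hq : q ∈ Set.Ioo (-1 : ℝ) 1)
    (hq₀ : q₀ ∈ Set.Ioo (-1 : ℝ) 1) (hq₁ : q₁ ∈ Set.Ioo (-1 : ℝ) 1) {lam : Fin 1 → ℤ}
    (hlam : lam ∈ alcove m 1) :
    christoffel m q q₀ q₁ lam = (hessian m q q₀ q₁ lam (node m q q₀ q₁ lam)).det⁻¹ := by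
  have heq := node_one_eq m hq hq₀ hq₁ lam rfl
  obtain ⟨ha0, hap⟩ := node_one_bounds m hq hq₀ hq₁ hlam rfl
  set ξ := node m q q₀ q₁ lam with hξ
  have hn := norm_phase (ξ 0)
  have hx0 := phase_ne_zero (ξ 0)
  have hx := conj_phase (ξ 0)
  have hx1 : phase (ξ 0) ^ 2 - 1 ≠ 0 := by
    rw [sq, ← phase_add, sub_ne_zero]
    exact phase_ne_one (by linarith) (by linarith)
  have hbethe : (phase (ξ 0) ^ 2) ^ (m + 1)
      * (scat (q₀ : ℂ) (phase (ξ 0)) * scat (q₁ : ℂ) (phase (ξ 0))) = 1 := by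
    rw [← phase_v hq₀, ← phase_v hq₁, ← pow_mul, ← phase_natCast_mul, ← phase_add, ← phase_add,
      ← phase_two_pi_mul_int (1 + lam 0)]
    congr 1
    push_cast
    linarith
  refine christoffel_eq ?_ ?_
  · rw [C_one]
    exact shortFactor_ne_zero hx0 hx1 (phase_sub_ne_zero hq₀ hn)
  have hP : ∀ l : ℕ, ((‖P q q₀ ![(l : ℤ)] ξ‖ ^ 2 : ℝ) : ℂ)
      = (shortFactor (q₀ : ℂ) (phase (ξ 0)) * phase (ξ 0) ^ l
      + shortFactor (q₀ : ℂ) (phase (ξ 0))⁻¹ * (phase (ξ 0))⁻¹ ^ l) ^ 2 := fun l => by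
    rw [P_one q q₀ l ξ _ rfl, Complex.ofReal_pow, ← Complex.mul_conj', sq]
    have hx' : (starRingEnd ℂ) (phase (ξ 0))⁻¹ = (phase (ξ 0))⁻¹⁻¹ := by rw [map_inv₀, hx]
    rw [map_add, map_mul, map_mul, map_pow, map_pow, conj_shortFactor q₀ hx,
      conj_shortFactor q₀ hx', hx, hx', inv_inv]
    ring
  have key := sum_shortFactor_sq hx0 hx1 (one_sub_mul_phase_ne_zero hq₀ hn)
    (phase_sub_ne_zero hq₀ hn) (one_sub_mul_phase_ne_zero hq₁ hn) (phase_sub_ne_zero hq₁ hn) hbethe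
  rw [C_one, conj_shortFactor q₀ hx, det_hessian_one m hq hq₀ hq₁, sum_alcove_one]
  push_cast at key hP ⊢
  rw [u_eq_poisson hq₀, u_eq_poisson hq₁, ← key]
  refine sum_congr rfl fun l _ => ?_
  rw [hP, delta_one, Complex.ofReal_one, mul_one]

theorem christoffel_two (m : ℕ) {q q₀ q₁ : ℝ} (hq : q ∈ Set.Ioo (-1 : ℝ) 1)
    (hq₀ : q₀ ∈ Set.Ioo (-1 : ℝ) 1) (hq₁ : q₁ ∈ Set.Ioo (-1 : ℝ) 1) {lam : Fin 2 → ℤ}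
    (hlam : lam ∈ alcove m 2) :
    christoffel m q q₀ q₁ lam = (hessian m q q₀ q₁ lam (node m q q₀ q₁ lam)).det⁻¹ := by
  have hB := bethe_of_node m hq hq₀ hq₁ hlam rfl rfl
  set ξ := node m q q₀ q₁ lam with hξ
  have hx := conj_phase (ξ 0)
  have hy := conj_phase (ξ 1)
  have hdiv : ∀ z : ℂ, phase (ξ 0) / phase (ξ 1) - z = (phase (ξ 0) - z * phase (ξ 1)) / phase (ξ 1) :=
    fun z => by rw [div_sub' hB.gen.y0, mul_comm z]
  refine christoffel_eq ?_ ?_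
  · rw [C_two, coeffC]
    refine mul_ne_zero (mul_ne_zero (shortFactor_ne_zero hB.gen.x0 hB.gen.x1 hB.x0')
      (shortFactor_ne_zero hB.gen.y0 hB.gen.y1 hB.y0'))
      (mul_ne_zero (longFactor_ne_zero (div_ne_zero hB.gen.x0 hB.gen.y0) ?_ ?_)
      (longFactor_ne_zero (mul_ne_zero hB.gen.x0 hB.gen.y0) hB.gen.xy hB.gen.xyq))
    · rw [hdiv, one_mul]; exact div_ne_zero hB.gen.x_y hB.gen.y0
    · rw [hdiv]; exact div_ne_zero hB.gen.xqy hB.gen.y0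
  have hP : ∀ l k : ℕ, ((‖P q q₀ ![(l : ℤ), k] ξ‖ ^ 2 : ℝ) : ℂ)
      = hallLittlewood (q : ℂ) q₀ l k (phase (ξ 0)) (phase (ξ 1)) ^ 2 := fun l k => by
    rw [P_two q q₀ l k ξ _ rfl rfl, Complex.ofReal_pow, ← Complex.mul_conj',
      conj_hallLittlewood q q₀ l k hx hy, sq]
  have hδ : ∀ l : ℕ, ((delta q ![(l : ℤ), l] : ℝ) : ℂ) = 1 / (1 + q) := fun l => by
    have h1 := hB.gen.q1
    have h2 : (1 - q : ℂ) ≠ 0 := by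
      have := hq.2
      exact_mod_cast (by linarith : (1 : ℝ) - q ≠ 0)
    rw [delta_two, if_pos (by simp)]
    push_cast
    rw [show (1 - (q : ℂ) ^ 2) = (1 + q) * (1 - q) by ring]
    field_simp
  have hδ' : ∀ l k : ℕ, k < l → delta q ![(l : ℤ), k] = 1 := fun l k hlk => by
    rw [delta_two, if_neg]
    simp
    omega
  rw [C_two, conj_coeffC q q₀ hx hy, det_hessian_two m hq hq₀ hq₁, sum_alcove_two]
  have key := sum_hallLittlewood_sq hB
  push_cast at key hP ⊢
  rw [u_eq_poisson hq₀, u_eq_poisson hq₀, u_eq_poisson hq₁, u_eq_poisson hq₁, u_eq_poisson hq,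
    u_eq_poisson hq, phase_add, phase_sub, ← key]
  refine sum_congr rfl fun l _ => ?_
  rw [hP, hδ, mul_comm _ (1 / (1 + (q : ℂ)))]
  congr 1
  refine sum_congr rfl fun k hk => ?_
  rw [hP, hδ' l k (mem_range.1 hk), Complex.ofReal_one, mul_one]

end HyperoctahedralHL

theorem mainTheorem7 (n m : ℕ) (hn1 : 1 ≤ n) (hn2 : n ≤ 2) (hm : 0 < m) (q q₀ q₁ : ℝ)
    (hq : q ∈ Set.Ioo (-1 : ℝ) 1) (hq₀ : q₀ ∈ Set.Ioo (-1 : ℝ) 1) (hq₁ : q₁ ∈ Set.Ioo (-1 : ℝ) 1)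
    (lam : Fin n → ℤ) (hlam : lam ∈ HyperoctahedralHL.alcove m n) :
    HyperoctahedralHL.christoffel m q q₀ q₁ lam =
      (HyperoctahedralHL.hessian m q q₀ q₁ lam
        (HyperoctahedralHL.node m q q₀ q₁ lam)).det⁻¹ := by
  obtain rfl | rfl : n = 1 ∨ n = 2 := by omega
  · exact HyperoctahedralHL.christoffel_one m hq hq₀ hq₁ hlam
  · exact HyperoctahedralHL.christoffel_two m hq hq₀ hq₁ hlam
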